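/- Let $\Bbbk$ be an algebraically closed field of characteristic $0$, let $U$ be an associative unital $\Bbbk$-algebra, and let $\Gamma\subset U$ be a finitely generated commutative subalgebra which is a Harish-Chandra subalgebra: for every $u\in U$ the bimodule $\Gamma u\Gamma$ is finitely generated both as a left and as a right $\Gamma$-module. Let $F(U)$ be the directed set of finitely generated $\Gamma$-subbimodules of $U$, and let $\mathcal A$ be the $\Bbbk$-linear category whose objects are the maximal ideals of $\Gamma$, with $$\mathcal A(\mathfrak m,\mathfrak n)=\varinjlim_{V\in F(U)}\ \varprojlim_{a,b}\ V/(\mathfrak n^aV+V\mathfrak m^b),$$ each $\mathcal A(\mathfrak m,\mathfrak n)$ carrying the direct limit (finest) topology of the inverse limits of the discrete spaces $V/(\mathfrak n^aV+V\mathfrak m^b)$. The composition $\mathcal A(\mathfrak p,\mathfrak n)\times\mathcal A(\mathfrak m,\mathfrak p)\to\mathcal A(\mathfrak m,\mathfrak n)$ is induced by the multiplication of $U$: for $V,W\in F(U)$, modulo $\mathfrak n^aVW+VW\mathfrak m^b$ the product of the classes of $v\in V$ and $w\in W$, taken modulo $\mathfrak n^aV+V\mathfrak p^c$ and $\mathfrak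 p^cW+W\mathfrak m^b$ with $c$ large, is the class of $v\gamma w$, where $\gamma\in\Gamma$ with $\gamma\equiv 1 \pmod{\mathfrak p^c}$ acts on the finite-dimensional right $\Gamma$-module $V/\mathfrak n^aV$ as the projection onto its $\mathfrak p$-primary component. Let $u_{\mathfrak n,\mathfrak m}$ be the image of $u\in U$ in $\mathcal A(\mathfrak m,\mathfrak n)$. For a set $D$ of maximal ideals of $\Gamma$, let $M_D\subset\prod_{(\mathfrak n,\mathfrak m)\in D\times D}\mathcal A(\mathfrak m,\mathfrak n)$ be the algebra of those $D\times D$ matrices, with entry in row $\mathfrak n$ and column $\mathfrak m$ from $\mathcal A(\mathfrak m,\mathfrak n)$, which have finitely many nonzero entries in every row and in every column; it carries the topology induced by the product topology. Write $M_{\mathcal A}$ for $M_D$ with $D$ the set of all maximal ideals, and let $\pi_D:M_{\mathcal A}\to M_D$ be the restriction to rows and columns in $D$. Let $\Delta$ be the smallest equivalence relation on the set of maximal ideals of $\Gamma$ for which $\mathfrak m$ and $\mathfrak n$ are equivalent whenever $\Gamma/\mathfrak n\otimes_\Gamma\Gamma u\Gamma\otimes_\Gamma\Gamma/\mathfrak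 m\neq 0$ for some $u\in U$. Then: 1. For every $u\in U$ the matrix $[u]$ with entry $u_{\mathfrak n,\mathfrak m}$ in row $\mathfrak n$ and column $\mathfrak m$ lies in $M_{\mathcal A}$, and $u\mapsto[u]$ is a homomorphism of $\Bbbk$-algebras $i_{\mathcal A}:U\to M_{\mathcal A}$. 2. For every equivalence class $D$ of $\Delta$ the image of $\pi_D\circ i_{\mathcal A}$ is dense in $M_D$. -/

import Mathlib

open CategoryTheory
open scoped IsMulCommutative

universe u v w

/-! ### Row- and column-finite matrices over a `k`-linear category -/

section Matrices

variable (k : Type w) [Field k] {C : Type u} [Category.{v} C] [Preadditive C] [Linear k C]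

/-- For a family `X : I → C` of objects of a `k`-linear category: the space `M_I` of all
`I × I` matrices `F` whose entry in row `i` and column `j` is a morphism `X j ⟶ X i`, with finitely
many nonzero entries in every row and in every column. -/
def RCFMatrix {I : Type*} (X : I → C) : Submodule k (∀ i j : I, X j ⟶ X i) where
  carrier := {F | (∀ i, {j | F i j ≠ 0}.Finite) ∧ ∀ j, {i | F i j ≠ 0}.Finite}
  add_mem' := by
    rintro F G ⟨hF, hF'⟩ ⟨hG, hG'⟩
    refine ⟨fun i => ((hF i).union (hG i)).subset ?_, fun j => ((hF' j).union (hG' j)).subset ?_⟩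
    · intro j hj
      by_contra h
      simp only [Set.mem_union, Set.mem_ofPred_eq, not_or, not_not] at h
      exact hj (by simp [h.1, h.2])
    · intro i hi
      by_contra h
      simp only [Set.mem_union, Set.mem_ofPred_eq, not_or, not_not] at h
      exact hi (by simp [h.1, h.2])
  zero_mem' := by simp
  smul_mem' := by
    rintro c F ⟨hF, hF'⟩
    refine ⟨fun i => (hF i).subset ?_, fun j => (hF' j).subset ?_⟩
    · intro j hj h
      exact hj (by simp [h])
    · intro i hi h
      exact hi (by simp [h])

namespace RCFMatrix

variable {k} {I : Type*} {X : I → C}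

theorem ext' {F G : RCFMatrix k X} (h : ∀ i j, F.1 i j = G.1 i j) : F = G :=
  Subtype.ext (funext fun i => funext fun j => h i j)

/-- The (row `i`) by (column `j`) product: the sum over `l` of the composites
`X j ⟶ X l ⟶ X i` of `G l j` and `F i l`; only finitely many of them are nonzero. -/
noncomputable def mulEntry (F G : RCFMatrix k X) (i j : I) : X j ⟶ X i :=
  ∑ l ∈ (F.2.1 i).toFinset, G.1 l j ≫ F.1 i l

theorem mulEntry_eq_sum (F G : RCFMatrix k X) (i j : I) (s : Finset I)
    (hs : ∀ l, F.1 i l ≠ 0 → l ∈ s) : mulEntry F G i j = ∑ l ∈ s, G.1 l j ≫ F.1 i l := by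
  refine Finset.sum_subset (fun l hl => hs l (by simpa using hl)) fun l _ hl => ?_
  have : F.1 i l = 0 := by simpa using hl
  simp [this]

noncomputable instance : Mul (RCFMatrix k X) where
  mul F G := ⟨mulEntry F G, by
    classical
    constructor
    · intro i
      refine ((F.2.1 i).toFinset.biUnion fun l => (G.2.1 l).toFinset).finite_toSet.subset ?_
      intro j hj
      obtain ⟨l, hl, h⟩ := Finset.exists_ne_zero_of_sum_ne_zero hj
      simp only [Finset.coe_biUnion, Set.mem_iUnion]
      refine ⟨l, hl, ?_⟩
      simp only [Set.Finite.coe_toFinset, Set.mem_ofPred_eq]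
      intro h0
      exact h (by simp [h0])
    · intro j
      refine ((G.2.2 j).toFinset.biUnion fun l => (F.2.2 l).toFinset).finite_toSet.subset ?_
      intro i hi
      obtain ⟨l, hl, h⟩ := Finset.exists_ne_zero_of_sum_ne_zero hi
      simp only [Finset.coe_biUnion, Set.mem_iUnion]
      refine ⟨l, ?_, ?_⟩
      · simp only [Set.Finite.coe_toFinset, Set.mem_ofPred_eq]
        intro h0
        exact h (by simp [h0])
      · simp only [Set.Finite.coe_toFinset, Set.mem_ofPred_eq]
        intro h0
        exact h (by simp [h0])⟩

theorem mul_apply (F G : RCFMatrix k X) (i j : I) : (F * G).1 i j = mulEntry F G i j := rfl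

open Classical in
/-- The matrix with identity morphisms on the diagonal and zeros elsewhere. -/
noncomputable instance : One (RCFMatrix k X) where
  one := ⟨fun i j => if h : j = i then eqToHom (by rw [h]) else 0, by
    constructor
    · intro i
      refine (Set.finite_singleton i).subset fun j hj => ?_
      by_contra h
      exact hj (dif_neg h)
    · intro i
      refine (Set.finite_singleton i).subset fun j hj => ?_
      by_contra h
      exact hj (dif_neg fun h' => h h'.symm)⟩

theorem one_apply_same (i : I) : (1 : RCFMatrix k X).1 i i = 𝟙 (X i) := by
  exact (dif_pos rfl).trans (by simp)

theorem add_apply (F G : RCFMatrix k X) (i j : I) : (F + G).1 i j = F.1 i j + G.1 i j := rfl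

theorem smul_apply (c : k) (F : RCFMatrix k X) (i j : I) : (c • F).1 i j = c • F.1 i j := rfl

theorem one_apply_ne {i j : I} (h : j ≠ i) : (1 : RCFMatrix k X).1 i j = 0 := dif_neg h

theorem mul_assoc' (F G H : RCFMatrix k X) : F * G * H = F * (G * H) := by
  classical
  refine ext' fun i j => ?_
  set s := (F.2.1 i).toFinset
  set t := s.biUnion fun l => (G.2.1 l).toFinset
  have hs : ∀ l, F.1 i l ≠ 0 → l ∈ s := fun l hl => by simpa [s] using hl
  have ht : ∀ l ∈ s, ∀ p, G.1 l p ≠ 0 → p ∈ t := fun l hl p hp =>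
    Finset.mem_biUnion.2 ⟨l, hl, by simpa using hp⟩
  have h1 : ∀ p, (F * G).1 i p ≠ 0 → p ∈ t := fun p hp => by
    obtain ⟨l, hl, h⟩ := Finset.exists_ne_zero_of_sum_ne_zero hp
    exact ht l hl p fun h0 => h (by simp [h0])
  rw [mul_apply, mul_apply, mulEntry_eq_sum _ _ _ _ t h1, mulEntry_eq_sum _ _ _ _ s hs]
  have h2 : ∀ l ∈ s, (G * H).1 l j ≫ F.1 i l = ∑ p ∈ t, H.1 p j ≫ G.1 l p ≫ F.1 i l :=
    fun l hl => by
      rw [mul_apply, mulEntry_eq_sum _ _ _ _ t (ht l hl), Preadditive.sum_comp]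
      simp
  have h3 : ∀ p ∈ t, H.1 p j ≫ (F * G).1 i p = ∑ l ∈ s, H.1 p j ≫ G.1 l p ≫ F.1 i l :=
    fun p _ => by
      rw [mul_apply, mulEntry_eq_sum _ _ _ _ s hs, Preadditive.comp_sum]
  rw [Finset.sum_congr rfl h2, Finset.sum_congr rfl h3, Finset.sum_comm]

noncomputable instance : Ring (RCFMatrix k X) :=
  { (inferInstance : AddCommGroup (RCFMatrix k X)),
    (inferInstance : Mul (RCFMatrix k X)), (inferInstance : One (RCFMatrix k X)) with
    mul_assoc := mul_assoc'
    one_mul := fun F => ext' fun i j => by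
      classical
      rw [mul_apply, mulEntry_eq_sum (1 : RCFMatrix k X) F i j {i} fun l hl => ?_]
      · rw [Finset.sum_singleton, one_apply_same, Category.comp_id]
      · by_contra h
        exact hl (one_apply_ne (by simpa using h))
    mul_one := fun F => ext' fun i j => by
      classical
      rw [mul_apply, mulEntry_eq_sum _ _ _ _ (insert j (F.2.1 i).toFinset) fun l hl => by
        simp [hl], Finset.sum_eq_single_of_mem j (by simp), one_apply_same, Category.id_comp]
      intro l _ hl
      rw [one_apply_ne hl.symm, Limits.zero_comp]
    left_distrib := fun F G H => ext' fun i j => by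
      rw [add_apply, mul_apply, mul_apply, mul_apply]
      simp only [mulEntry, ← Finset.sum_add_distrib, ← Preadditive.add_comp]
      rfl
    right_distrib := fun F G H => ext' fun i j => by
      classical
      rw [add_apply, mul_apply, mul_apply, mul_apply]
      set s := (F.2.1 i).toFinset ∪ (G.2.1 i).toFinset
      rw [mulEntry_eq_sum F _ _ _ s fun l hl => by simp [s, hl],
        mulEntry_eq_sum G _ _ _ s fun l hl => by simp [s, hl],
        mulEntry_eq_sum (F + G) _ _ _ s fun l hl => ?_]
      · simp only [← Finset.sum_add_distrib, ← Preadditive.comp_add]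
        rfl
      · by_contra h
        simp only [s, Finset.mem_union, Set.Finite.mem_toFinset, Set.mem_ofPred_eq, not_or,
          not_not] at h
        apply hl
        change F.1 i l + G.1 i l = 0
        rw [h.1, h.2, add_zero]
    zero_mul := fun F => ext' fun i j => by
      rw [mul_apply, mulEntry_eq_sum (0 : RCFMatrix k X) F i j ∅ fun l hl => (hl rfl).elim]
      rfl
    mul_zero := fun F => ext' fun i j => Finset.sum_eq_zero fun l _ => by
      change (0 : X j ⟶ X l) ≫ _ = _
      simp }

noncomputable instance : Algebra k (RCFMatrix k X) :=
  Algebra.ofModule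
    (fun c F G => ext' fun i j => by
      classical
      rw [smul_apply, mul_apply, mul_apply]
      rw [mulEntry_eq_sum (c • F) _ _ _ (F.2.1 i).toFinset fun l hl => ?_]
      · simp only [mulEntry, Finset.smul_sum]
        exact Finset.sum_congr rfl fun l _ => Linear.comp_smul _ _ _ _ _ _
      · simp only [Set.Finite.mem_toFinset, Set.mem_ofPred_eq]
        intro h
        apply hl
        change c • F.1 i l = 0
        rw [h, smul_zero])
    (fun c F G => ext' fun i j => by
      rw [smul_apply, mul_apply, mul_apply]
      simp only [mulEntry, Finset.smul_sum]
      exact Finset.sum_congr rfl fun l _ => Linear.smul_comp _ _ _ _ _ _)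

/-- The block of a matrix with rows and columns in `D ⊆ I`. -/
def block (D : Set I) : RCFMatrix k X →ₗ[k] RCFMatrix k (fun d : D => X d) where
  toFun F := ⟨fun i j => F.1 i j,
    fun i => (F.2.1 i).preimage Subtype.val_injective.injOn,
    fun j => (F.2.2 j).preimage Subtype.val_injective.injOn⟩
  map_add' _ _ := rfl
  map_smul' _ _ := rfl

end RCFMatrix

end Matrices

/-! ### Harish-Chandra subalgebras and finitary completions -/

section GelfandTsetlin

variable {k : Type w} {U : Type u} [Field k] [Ring U] [Algebra k U]

/-- A commutative subalgebra `Γ` of `U` is a Harish-Chandra subalgebra if for every `u ∈ U` the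
bimodule `Γ u Γ` is finitely generated both as a left and as a right `Γ`-module.
(Products are products of `k`-subspaces of `U`.) -/
class IsHarishChandra (Γ : Subalgebra k U) : Prop where
  left_fg : ∀ u : U, ∃ S : Finset U,
    Γ.toSubmodule * Submodule.span k {u} * Γ.toSubmodule = Γ.toSubmodule * Submodule.span k S
  right_fg : ∀ u : U, ∃ S : Finset U,
    Γ.toSubmodule * Submodule.span k {u} * Γ.toSubmodule = Submodule.span k S * Γ.toSubmodule

variable (Γ : Subalgebra k U)

/-- `F(U)`: the finitely generated `Γ`-subbimodules `V = Γ S Γ` (`S` finite) of `U`, ordered by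
inclusion. -/
abbrev FGBimod : Type u :=
  {V : Submodule k U // ∃ S : Finset U, V = Γ.toSubmodule * Submodule.span k S * Γ.toSubmodule}

noncomputable instance : DecidableEq (FGBimod Γ) := Classical.decEq _

/-- The bimodule `Γ u Γ`. -/
def FGBimod.gen (u : U) : FGBimod Γ :=
  ⟨Γ.toSubmodule * Submodule.span k {u} * Γ.toSubmodule, {u}, by simp⟩

variable {Γ}

theorem FGBimod.left_mem (V : FGBimod Γ) {g v : U} (hg : g ∈ Γ) (hv : v ∈ V.1) : g * v ∈ V.1 := by
  obtain ⟨V, S, rfl⟩ := V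
  have h : g * v ∈ Γ.toSubmodule * (Γ.toSubmodule * Submodule.span k S * Γ.toSubmodule) :=
    Submodule.mul_mem_mul hg hv
  rwa [← mul_assoc, ← mul_assoc, (Subalgebra.isIdempotentElem_toSubmodule Γ).eq] at h

theorem FGBimod.right_mem (V : FGBimod Γ) {g v : U} (hv : v ∈ V.1) (hg : g ∈ Γ) :
    v * g ∈ V.1 := by
  obtain ⟨V, S, rfl⟩ := V
  have h : v * g ∈ (Γ.toSubmodule * Submodule.span k S * Γ.toSubmodule) * Γ.toSubmodule :=
    Submodule.mul_mem_mul hv hg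
  rwa [mul_assoc _ Γ.toSubmodule, (Subalgebra.isIdempotentElem_toSubmodule Γ).eq] at h

theorem FGBimod.mem_gen (u : U) : u ∈ (FGBimod.gen Γ u).1 := by
  have h : 1 * u * 1 ∈ Γ.toSubmodule * Submodule.span k {u} * Γ.toSubmodule :=
    Submodule.mul_mem_mul (Submodule.mul_mem_mul Γ.one_mem (Submodule.mem_span_singleton_self u))
      Γ.one_mem
  rw [one_mul, mul_one] at h
  exact h

theorem FGBimod.exists_left_fg [IsHarishChandra Γ] (V : FGBimod Γ) :
    ∃ S : Finset U, V.1 = Γ.toSubmodule * Submodule.span k S := by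
  classical
  obtain ⟨V, S, rfl⟩ := V
  induction S using Finset.induction with
  | empty => exact ⟨∅, by simp⟩
  | insert u S _ ih =>
    obtain ⟨T, hT⟩ := ih
    obtain ⟨T', hT'⟩ := IsHarishChandra.left_fg (Γ := Γ) u
    refine ⟨T' ∪ T, ?_⟩
    simp only at hT ⊢
    rw [Finset.coe_insert, Submodule.span_insert, Submodule.mul_sup, Submodule.sup_mul, hT, hT',
      Finset.coe_union, Submodule.span_union, Submodule.mul_sup]

/-- The product `VW`: the span of all `v w` with `v ∈ V`, `w ∈ W`. -/
def FGBimod.mul [IsHarishChandra Γ] (V W : FGBimod Γ) : FGBimod Γ :=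
  ⟨V.1 * W.1, by
    classical
    obtain ⟨S, hS⟩ := V.exists_left_fg
    obtain ⟨W, T, rfl⟩ := W
    refine ⟨Finset.image₂ (· * ·) S T, ?_⟩
    have hV : V.1 * Γ.toSubmodule = V.1 := by
      obtain ⟨V, S, rfl⟩ := V
      simp only [mul_assoc, (Subalgebra.isIdempotentElem_toSubmodule Γ).eq]
    simp only
    rw [← mul_assoc, ← mul_assoc, hV, hS, mul_assoc Γ.toSubmodule, Submodule.span_mul_span,
      Finset.coe_image₂, Set.image2_mul]⟩

theorem FGBimod.mul_mono [IsHarishChandra Γ] {V V' W W' : FGBimod Γ} (hV : V ≤ V') (hW : W ≤ W') :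
    V.mul W ≤ V'.mul W' :=
  mul_le_mul' (show V.1 ≤ V'.1 from hV) hW

noncomputable instance : Nonempty (FGBimod Γ) := ⟨FGBimod.gen Γ 1⟩

instance : IsDirectedOrder (FGBimod Γ) where
  directed := by
    classical
    rintro ⟨V, S, rfl⟩ ⟨W, T, rfl⟩
    refine ⟨⟨_, S ∪ T, rfl⟩, ?_, ?_⟩
    · exact mul_le_mul' (mul_le_mul' le_rfl (Submodule.span_mono (by simp))) le_rfl
    · exact mul_le_mul' (mul_le_mul' le_rfl (Submodule.span_mono (by simp))) le_rfl

/-- An ideal of `Γ` as a `k`-subspace of `U`. -/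
def idealSub (I : Ideal Γ) : Submodule k U := (I.restrictScalars k).map Γ.val.toLinearMap

theorem idealSub_mono {I J : Ideal Γ} (h : I ≤ J) : idealSub I ≤ idealSub J :=
  Submodule.map_mono h

theorem mem_idealSub {I : Ideal Γ} {x : Γ} (hx : x ∈ I) : (x : U) ∈ idealSub I :=
  ⟨x, hx, rfl⟩

theorem idealSub_mul_right (V : FGBimod Γ) (I : Ideal Γ) {y : U} (hy : y ∈ idealSub I * V.1)
    (g : Γ) : y * g ∈ idealSub I * V.1 := by
  induction hy using Submodule.mul_induction_on' with
  | mem_mul_mem i hi v hv =>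
    rw [mul_assoc]
    exact Submodule.mul_mem_mul hi (V.right_mem hv g.2)
  | add x _ y _ hx hy =>
    rw [add_mul]
    exact add_mem hx hy

theorem mul_cut_mem {V W T : FGBimod Γ} (hT : V.1 * W.1 ≤ T.1) {v w : U} (hv : v ∈ V.1) (γ : Γ) (hw : w ∈ W.1) :
    v * γ * w ∈ T.1 :=
  hT (Submodule.mul_mem_mul (V.right_mem hv γ.2) hw)

variable [IsMulCommutative Γ]

/-- The sub-bimodule `𝔫ᵃ V + V 𝔪ᵇ`. -/
def filt (n m : Ideal Γ) (V : FGBimod Γ) (a b : ℕ) : Submodule k U :=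
  idealSub (n ^ a) * V.1 ⊔ V.1 * idealSub (m ^ b)

/-- `V / (𝔫ᵃ V + V 𝔪ᵇ)`. -/
def filtQuot (n m : Ideal Γ) (V : FGBimod Γ) (a b : ℕ) : Type u :=
  V.1 ⧸ (filt n m V a b).submoduleOf V.1

instance (n m : Ideal Γ) (V : FGBimod Γ) (a b : ℕ) : AddCommGroup (filtQuot n m V a b) :=
  Submodule.Quotient.addCommGroup ((filt n m V a b).submoduleOf V.1)

instance (n m : Ideal Γ) (V : FGBimod Γ) (a b : ℕ) : Module k (filtQuot n m V a b) :=
  Submodule.Quotient.module ((filt n m V a b).submoduleOf V.1)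

/-- The quotient map `V ⟶ V / (𝔫ᵃ V + V 𝔪ᵇ)`. -/
def filtMk (n m : Ideal Γ) (V : FGBimod Γ) (a b : ℕ) : V.1 →ₗ[k] filtQuot n m V a b :=
  ((filt n m V a b).submoduleOf V.1).mkQ

theorem filtMk_surjective (n m : Ideal Γ) (V : FGBimod Γ) (a b : ℕ) :
    Function.Surjective (filtMk n m V a b) :=
  Submodule.mkQ_surjective _

theorem filtMk_eq_iff (n m : Ideal Γ) (V : FGBimod Γ) (a b : ℕ) (v v' : V.1) :
    filtMk n m V a b v = filtMk n m V a b v' ↔ (v : U) - v' ∈ filt n m V a b :=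
  Submodule.Quotient.eq ((filt n m V a b).submoduleOf V.1)

theorem filt_anti (n m : Ideal Γ) (V : FGBimod Γ) {a a' b b' : ℕ} (ha : a ≤ a') (hb : b ≤ b') :
    filt n m V a' b' ≤ filt n m V a b :=
  sup_le_sup (mul_le_mul' (idealSub_mono (Ideal.pow_le_pow_right ha)) le_rfl)
    (mul_le_mul' le_rfl (idealSub_mono (Ideal.pow_le_pow_right hb)))

theorem filt_mono (n m : Ideal Γ) {V W : FGBimod Γ} (h : V ≤ W) (a b : ℕ) :
    filt n m V a b ≤ filt n m W a b :=
  sup_le_sup (mul_le_mul' le_rfl h) (mul_le_mul' h le_rfl)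

/-- The projection from `V / (𝔫ᵃ' V + V 𝔪ᵇ')` to `V / (𝔫ᵃ V + V 𝔪ᵇ)` for `a ≤ a'`, `b ≤ b'`. -/
def filtProj (n m : Ideal Γ) (V : FGBimod Γ) {a a' b b' : ℕ} (ha : a ≤ a') (hb : b ≤ b') :
    filtQuot n m V a' b' →ₗ[k] filtQuot n m V a b :=
  Submodule.mapQ ((filt n m V a' b').submoduleOf V.1) ((filt n m V a b).submoduleOf V.1)
    LinearMap.id fun _ hx => filt_anti n m V ha hb hx

/-- The map `V / (𝔫ᵃ V + V 𝔪ᵇ) ⟶ W / (𝔫ᵃ W + W 𝔪ᵇ)` induced by an inclusion `V ⊆ W`. -/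
def filtIncl (n m : Ideal Γ) {V W : FGBimod Γ} (h : V ≤ W) (a b : ℕ) :
    filtQuot n m V a b →ₗ[k] filtQuot n m W a b :=
  Submodule.mapQ ((filt n m V a b).submoduleOf V.1) ((filt n m W a b).submoduleOf W.1)
    (Submodule.inclusion h) fun _ hy => filt_mono n m h a b hy

/-- The completion `lim_{a,b} V / (𝔫ᵃ V + V 𝔪ᵇ)`. -/
def Completion (n m : Ideal Γ) (V : FGBimod Γ) :
    Submodule k (∀ a b : ℕ, filtQuot n m V a b) where
  carrier := {x | ∀ (a a' b b' : ℕ) (ha : a ≤ a') (hb : b ≤ b'),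
    filtProj n m V ha hb (x a' b') = x a b}
  add_mem' hx hy a a' b b' ha hb := by
    rw [Pi.add_apply, Pi.add_apply, Pi.add_apply, Pi.add_apply, map_add, hx a a' b b' ha hb,
      hy a a' b b' ha hb]
  zero_mem' a a' b b' ha hb := map_zero _
  smul_mem' c x hx a a' b b' ha hb := by
    rw [Pi.smul_apply, Pi.smul_apply, Pi.smul_apply, Pi.smul_apply, map_smul, hx a a' b b' ha hb]

/-- The inverse limit topology of the discrete spaces `V / (𝔫ᵃ V + V 𝔪ᵇ)`. -/
instance (n m : Ideal Γ) (V : FGBimod Γ) : TopologicalSpace (Completion n m V) :=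
  ⨅ (a : ℕ) (b : ℕ), TopologicalSpace.induced (fun x => x.1 a b) ⊥

/-- The element of the completion given by an element `v ∈ V`. -/
def Completion.const (n m : Ideal Γ) {V : FGBimod Γ} (v : U) (hv : v ∈ V.1) : Completion n m V :=
  ⟨fun a b => filtMk n m V a b ⟨v, hv⟩, fun _ _ _ _ _ _ => rfl⟩

/-- The map of completions induced by an inclusion `V ⊆ W`. -/
def Completion.trans (n m : Ideal Γ) (V W : FGBimod Γ) (h : V ≤ W) :
    Completion n m V →ₗ[k] Completion n m W where
  toFun x := ⟨fun a b => filtIncl n m h a b (x.1 a b), by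
    intro a a' b b' ha hb
    beta_reduce
    rw [← x.2 a a' b b' ha hb]
    obtain ⟨y, hy⟩ := filtMk_surjective n m V a' b' (x.1 a' b')
    rw [← hy]
    rfl⟩
  map_add' x y := by ext; simp
  map_smul' c x := by ext; simp

/-- The finitary completion of `U` at `(𝔫, 𝔪)`: the direct limit over `V ∈ F(U)` of
`lim_{a,b} V / (𝔫ᵃ V + V 𝔪ᵇ)`. -/
def FinitaryCompletion (n m : Ideal Γ) : Type u :=
  Module.DirectLimit (fun V : FGBimod Γ => Completion n m V) (Completion.trans n m)

namespace FinitaryCompletion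

noncomputable instance (n m : Ideal Γ) : AddCommGroup (FinitaryCompletion n m) :=
  Module.DirectLimit.addCommGroup (fun V : FGBimod Γ => Completion n m V) (Completion.trans n m)

noncomputable instance (n m : Ideal Γ) : Module k (FinitaryCompletion n m) :=
  Module.DirectLimit.module (G := fun V : FGBimod Γ => Completion n m V)
    (f := Completion.trans n m)

/-- The canonical map from the completion of `V` to the finitary completion. -/
noncomputable def of (n m : Ideal Γ) (V : FGBimod Γ) :
    Completion n m V →ₗ[k] FinitaryCompletion n m :=
  Module.DirectLimit.of k (FGBimod Γ) (fun V => Completion n m V) (Completion.trans n m) V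

theorem of_trans (n m : Ideal Γ) {V W : FGBimod Γ} (h : V ≤ W) (x : Completion n m V) :
    of n m W (Completion.trans n m V W h x) = of n m V x :=
  Module.DirectLimit.of_f (f := Completion.trans n m)

theorem exists_of {n m : Ideal Γ} (x : FinitaryCompletion n m) : ∃ V y, of n m V y = x :=
  Module.DirectLimit.exists_of (f := Completion.trans n m) x

/-- The universal property of the direct limit. -/
noncomputable def lift {n m : Ideal Γ} {P : Type*} [AddCommGroup P] [Module k P]
    (g : ∀ V : FGBimod Γ, Completion n m V →ₗ[k] P)
    (hg : ∀ V W h x, g W (Completion.trans n m V W h x) = g V x) :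
    FinitaryCompletion n m →ₗ[k] P :=
  Module.DirectLimit.lift k (FGBimod Γ) (fun V => Completion n m V) (Completion.trans n m) g hg

theorem lift_of {n m : Ideal Γ} {P : Type*} [AddCommGroup P] [Module k P]
    (g : ∀ V : FGBimod Γ, Completion n m V →ₗ[k] P)
    (hg : ∀ V W h x, g W (Completion.trans n m V W h x) = g V x) (V : FGBimod Γ)
    (x : Completion n m V) : lift g hg (of n m V x) = g V x :=
  Module.DirectLimit.lift_of (f := Completion.trans n m) g hg x

/-- The direct limit topology. -/
noncomputable instance (n m : Ideal Γ) : TopologicalSpace (FinitaryCompletion n m) :=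
  ⨆ V : FGBimod Γ, TopologicalSpace.coinduced (of n m V) inferInstance

/-- The image of `u ∈ U` in the finitary completion, through `u ∈ Γ u Γ`. -/
noncomputable def image (n m : Ideal Γ) (u : U) : FinitaryCompletion n m :=
  of n m (FGBimod.gen Γ u) (Completion.const n m u (FGBimod.mem_gen u))

end FinitaryCompletion

/-! ### Composition of morphisms -/

namespace Completion

variable {n m p q : Ideal Γ} {V W T : FGBimod Γ}

/-- `v` represents the component of `x` in `V / (𝔫ᵃ V + V 𝔪ᵇ)`. -/
def Rep (x : Completion n m V) (a b : ℕ) (v : U) : Prop :=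
  ∃ hv : v ∈ V.1, filtMk n m V a b ⟨v, hv⟩ = x.1 a b

theorem exists_rep (x : Completion n m V) (a b : ℕ) : ∃ v, Rep x a b v := by
  obtain ⟨⟨v, hv⟩, h⟩ := filtMk_surjective n m V a b (x.1 a b)
  exact ⟨v, hv, h⟩

theorem Rep.mono {x : Completion n m V} {a a' b b' : ℕ} {v : U} (h : Rep x a' b' v)
    (ha : a ≤ a') (hb : b ≤ b') : Rep x a b v := by
  obtain ⟨hv, h⟩ := h
  refine ⟨hv, ?_⟩
  rw [← x.2 a a' b b' ha hb, ← h]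
  rfl

theorem Rep.sub_mem {x : Completion n m V} {a b : ℕ} {v v' : U} (h : Rep x a b v)
    (h' : Rep x a b v') : v - v' ∈ filt n m V a b := by
  obtain ⟨hv, h⟩ := h
  obtain ⟨hv', h'⟩ := h'
  exact (filtMk_eq_iff n m V a b _ _).1 (h.trans h'.symm)

theorem Rep.of_sub_mem {x : Completion n m V} {a b : ℕ} {v v' : U} (h : Rep x a b v)
    (hv' : v' ∈ V.1) (h' : v - v' ∈ filt n m V a b) : Rep x a b v' := by
  obtain ⟨hv, h⟩ := h
  refine ⟨hv', ?_⟩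
  rw [← h]
  exact ((filtMk_eq_iff n m V a b _ _).2 h').symm

theorem ext_rep {x y : Completion n m V} (h : ∀ a b, ∃ v, Rep x a b v ∧ Rep y a b v) : x = y := by
  refine Subtype.ext (funext fun a => funext fun b => ?_)
  obtain ⟨v, ⟨hv, h1⟩, ⟨_, h2⟩⟩ := h a b
  exact h1.symm.trans h2

theorem Rep.add {x y : Completion n m V} {a b : ℕ} {v v' : U} (h : Rep x a b v)
    (h' : Rep y a b v') : Rep (x + y) a b (v + v') := by
  obtain ⟨hv, h⟩ := h
  obtain ⟨hv', h'⟩ := h'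
  refine ⟨add_mem hv hv', ?_⟩
  change _ = x.1 a b + y.1 a b
  rw [← h, ← h']
  rfl

theorem Rep.smul {x : Completion n m V} {a b : ℕ} {v : U} (c : k) (h : Rep x a b v) :
    Rep (c • x) a b (c • v) := by
  obtain ⟨hv, h⟩ := h
  refine ⟨Submodule.smul_mem _ c hv, ?_⟩
  change _ = c • x.1 a b
  rw [← h]
  rfl

theorem Rep.trans {x : Completion n m V} {a b : ℕ} {v : U} (h : Rep x a b v) (hVW : V ≤ W) :
    Rep (Completion.trans n m V W hVW x) a b v := by
  obtain ⟨hv, h⟩ := h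
  refine ⟨hVW hv, ?_⟩
  change _ = filtIncl n m hVW a b (x.1 a b)
  rw [← h]
  rfl

/-- `γ ∈ Γ` acts on the finite dimensional right `Γ`-module `V / 𝔫ᵃ V` as the projection onto its
`𝔭`-primary component: `γ ≡ 1` modulo `𝔭ᶜ` and `V γ 𝔭ᶜ ⊆ 𝔫ᵃ V`. -/
structure IsCut (n p : Ideal Γ) (V : FGBimod Γ) (a c : ℕ) (γ : Γ) : Prop where
  pos : 1 ≤ c
  one_sub : 1 - γ ∈ p ^ c
  mem : ∀ v ∈ V.1, ∀ x ∈ p ^ c, v * γ * x ∈ idealSub (n ^ a) * V.1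

theorem IsCut.mono {a a' c : ℕ} {γ : Γ} (h : IsCut n p V a' c γ) (ha : a ≤ a') :
    IsCut n p V a c γ :=
  ⟨h.pos, h.one_sub, fun v hv x hx =>
    mul_le_mul' (idealSub_mono (Ideal.pow_le_pow_right ha)) le_rfl (h.mem v hv x hx)⟩

theorem finite_quotient_pow [Algebra.FiniteType k Γ] (n : Ideal Γ) [n.IsMaximal] (a : ℕ) :
    Module.Finite k (Γ ⧸ n ^ a) := by
  rw [Module.finite_iff_krullDimLE_zero, Ring.krullDimLE_zero_iff]
  intro P hP
  have hP' : (P.comap (Ideal.Quotient.mk (n ^ a))).IsPrime := Ideal.comap_isPrime _ P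
  have hle : n ≤ P.comap (Ideal.Quotient.mk (n ^ a)) := by
    refine hP'.le_of_pow_le (n := a) fun x hx => ?_
    rw [Ideal.mem_comap, Ideal.Quotient.eq_zero_iff_mem.2 hx]
    exact P.zero_mem
  have heq := Ideal.IsMaximal.eq_of_le ‹_› hP'.ne_top hle
  have : (P.comap (Ideal.Quotient.mk (n ^ a))).IsMaximal := heq ▸ ‹n.IsMaximal›
  have h := Ideal.map_eq_top_or_isMaximal_of_surjective (Ideal.Quotient.mk (n ^ a))
    Ideal.Quotient.mk_surjective this
  rw [Ideal.map_comap_of_surjective _ Ideal.Quotient.mk_surjective] at h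
  exact h.resolve_left hP.ne_top

theorem exists_fg_sup_eq_top [Algebra.FiniteType k Γ] (n : Ideal Γ) [n.IsMaximal] (a : ℕ) :
    ∃ C : Submodule k U, C.FG ∧ Γ.toSubmodule ≤ idealSub (n ^ a) ⊔ C := by
  classical
  obtain ⟨t, ht⟩ := (finite_quotient_pow (k := k) n a).fg_top
  choose f hf using fun x : Γ ⧸ n ^ a => Ideal.Quotient.mk_surjective x
  refine ⟨Submodule.span k ((fun x => (f x : U)) '' (t : Set (Γ ⧸ n ^ a))),
    Submodule.fg_span (t.finite_toSet.image _), ?_⟩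
  intro g hg
  have key : ∀ y ∈ Submodule.span k (t : Set (Γ ⧸ n ^ a)), ∀ g : Γ,
      Ideal.Quotient.mk (n ^ a) g = y → (g : U) ∈ idealSub (n ^ a) ⊔
        Submodule.span k ((fun x => (f x : U)) '' (t : Set (Γ ⧸ n ^ a))) := by
    have hz : ∀ g g' : Γ, Ideal.Quotient.mk (n ^ a) g = Ideal.Quotient.mk (n ^ a) g' →
        ((g : U) - g') ∈ idealSub (k := k) (n ^ a) := fun g g' h => by
      have := mem_idealSub (k := k) (Ideal.Quotient.eq.1 h)
      simpa using this
    intro y hy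
    induction hy using Submodule.span_induction with
    | mem x hx =>
      intro g hg
      rw [← sub_add_cancel (g : U) (f x)]
      exact Submodule.add_mem_sup (hz g (f x) (hg.trans (hf x).symm))
        (Submodule.subset_span ⟨x, hx, rfl⟩)
    | zero =>
      intro g hg
      refine Submodule.mem_sup_left ?_
      simpa using hz g 0 (by simpa using hg)
    | add x y _ _ hx hy =>
      intro g hg
      have h1 := hx (f x) (hf x)
      have h2 := hy (f y) (hf y)
      have h3 := hz g (f x + f y) (by rw [hg, map_add, hf, hf])
      rw [← sub_add_cancel (g : U) ((f x + f y : Γ) : U)]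
      exact add_mem (Submodule.mem_sup_left h3) (by simpa using add_mem h1 h2)
    | smul c x _ hx =>
      intro g hg
      have h1 := hx (f x) (hf x)
      have h3 := hz g (c • f x) (by
        rw [hg, ← Ideal.Quotient.mkₐ_eq_mk k, map_smul, Ideal.Quotient.mkₐ_eq_mk, hf])
      rw [← sub_add_cancel (g : U) ((c • f x : Γ) : U)]
      exact add_mem (Submodule.mem_sup_left h3) (by simpa using Submodule.smul_mem _ c h1)
  exact key _ (by rw [ht]; trivial) ⟨g, hg⟩ rfl

theorem exists_isCut [Algebra.FiniteType k Γ] [IsHarishChandra Γ] (n p : Ideal Γ) [n.IsMaximal]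
    (V : FGBimod Γ) (a : ℕ) : ∃ c γ, IsCut n p V a c γ := by
  classical
  obtain ⟨S, hS⟩ := V.exists_left_fg
  obtain ⟨C, hC, hGC⟩ := exists_fg_sup_eq_top (k := k) n a
  set N : Submodule k U := idealSub (n ^ a) * V.1
  have hSV : ∀ s ∈ S, s ∈ V.1 := fun s hs => by
    rw [hS, ← one_mul s]
    exact Submodule.mul_mem_mul Γ.one_mem (Submodule.subset_span hs)
  -- `V / N` is finite dimensional
  set Q : Submodule k (U ⧸ N) := V.1.map N.mkQ
  have hQ : Q.FG := by
    have h1 : V.1 ≤ N ⊔ C * Submodule.span k S := by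
      conv_lhs => rw [hS]
      refine (mul_le_mul' hGC le_rfl).trans ?_
      rw [Submodule.sup_mul]
      exact sup_le_sup (mul_le_mul' le_rfl (Submodule.span_le.2 hSV)) le_rfl
    have h2 : Q ≤ (C * Submodule.span k S).map N.mkQ := by
      refine (Submodule.map_mono h1).trans ?_
      rw [Submodule.map_sup, Submodule.mkQ_map_self, bot_sup_eq]
    have h3 : (C * Submodule.span k (S : Set U)).FG :=
      hC.mul (Submodule.fg_span S.finite_toSet)
    have := Module.Finite.iff_fg.2 (h3.map N.mkQ)
    exact Module.Finite.iff_fg.1 (Submodule.finiteDimensional_of_le h2)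
  -- the annihilator of the right `Γ`-module `V / N`
  let J : Ideal Γ :=
    { carrier := {γ | ∀ v ∈ V.1, v * γ ∈ N}
      add_mem' := fun {x y} hx hy v hv => by
        rw [Subalgebra.coe_add, mul_add]
        exact add_mem (hx v hv) (hy v hv)
      zero_mem' := fun v _ => by simp
      smul_mem' := fun c x hx v hv => by
        rw [smul_eq_mul, Subalgebra.coe_mul, ← mul_assoc]
        exact hx _ (V.right_mem hv c.2) }
  let φ : Γ →ₗ[k] (S → Q) :=
    { toFun := fun γ s => ⟨N.mkQ (s * γ), _, V.right_mem (hSV _ s.2) γ.2, rfl⟩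
      map_add' := fun x y => by
        ext s
        simp [mul_add]
      map_smul' := fun c x => by
        ext s
        simp }
  have hker : (J.restrictScalars k) = LinearMap.ker φ := by
    ext γ
    rw [LinearMap.mem_ker, Submodule.restrictScalars_mem]
    constructor
    · intro h
      ext s
      exact (Submodule.Quotient.mk_eq_zero N).2 (h s (hSV _ s.2))
    · intro h v hv
      rw [hS] at hv
      have hs : ∀ s ∈ Submodule.span k (S : Set U), s * γ ∈ N := fun s hs => by
        induction hs using Submodule.span_induction with
        | mem x hx =>
          have := congrArg Subtype.val (congrFun h ⟨x, hx⟩)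
          exact (Submodule.Quotient.mk_eq_zero N).1 this
        | zero => simp
        | add x y _ _ hx hy => rw [add_mul]; exact add_mem hx hy
        | smul c x _ hx => rw [smul_mul_assoc]; exact Submodule.smul_mem _ c hx
      induction hv using Submodule.mul_induction_on' with
      | mem_mul_mem g hg s hs' =>
        rw [mul_assoc]
        have h1 := Submodule.mul_mem_mul (show g ∈ Γ.toSubmodule from hg) (hs s hs')
        rw [← mul_assoc] at h1
        have h2 : Γ.toSubmodule * idealSub (n ^ a) ≤ idealSub (k := k) (n ^ a) := by
          refine Submodule.mul_le.2 ?_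
          rintro g hg _ ⟨i, hi, rfl⟩
          exact mem_idealSub (Ideal.mul_mem_left _ (⟨g, hg⟩ : Γ) hi)
        have h3 : Γ.toSubmodule * idealSub (n ^ a) * V.1 ≤ N := mul_le_mul' h2 le_rfl
        exact h3 h1
      | add x _ y _ hx hy => rw [add_mul]; exact add_mem hx hy
  have : Module.Finite k Q := Module.Finite.iff_fg.2 hQ
  have hfin : Module.Finite k (Γ ⧸ J.restrictScalars k) := by
    have e := (Submodule.quotEquivOfEq _ _ hker).trans φ.quotKerEquivRange
    exact Module.Finite.equiv e.symm
  have hfin' : Module.Finite k (Γ ⧸ J) := hfin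
  have : IsArtinianRing (Γ ⧸ J) := IsArtinianRing.of_finite k (Γ ⧸ J)
  -- a power of the image of `p` is generated by an idempotent
  set P := p.map (Ideal.Quotient.mk J)
  obtain ⟨c, hc⟩ := IsArtinian.monotone_stabilizes
    (⟨fun i => OrderDual.toDual (P ^ i), fun i j h => Ideal.pow_le_pow_right h⟩ :
      ℕ →o (Ideal (Γ ⧸ J))ᵒᵈ)
  have hc' : ∀ i, c ≤ i → P ^ c = P ^ i := fun i hi => hc i hi
  have hid : IsIdempotentElem (P ^ (c + 1)) := by
    refine (pow_add P (c + 1) (c + 1)).symm.trans ?_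
    rw [← hc' (c + 1) (by omega), ← hc' (c + 1 + (c + 1)) (by omega)]
  obtain ⟨e, he, hPe⟩ := (Ideal.isIdempotentElem_iff_of_fg _ (IsNoetherian.noetherian _)).1 hid
  have heP : e ∈ (p ^ (c + 1)).map (Ideal.Quotient.mk J) := by
    rw [Ideal.map_pow, hPe]
    exact Ideal.mem_span_singleton_self e
  obtain ⟨δ, hδ, hδe⟩ := (Ideal.mem_map_iff_of_surjective _ Ideal.Quotient.mk_surjective).1 heP
  refine ⟨c + 1, 1 - δ, by omega, by simpa using hδ, fun v hv x hx => ?_⟩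
  have hmem : (1 - δ) * x ∈ J := by
    rw [← Ideal.Quotient.eq_zero_iff_mem, map_mul, map_sub, map_one, hδe]
    have hx' : Ideal.Quotient.mk J x ∈ P ^ (c + 1) := by
      rw [← Ideal.map_pow]
      exact Ideal.mem_map_of_mem _ hx
    rw [hPe] at hx'
    obtain ⟨y, hy⟩ := Ideal.mem_span_singleton'.1 hx'
    rw [← hy, mul_comm y e, ← mul_assoc, sub_mul, one_mul, he.eq, sub_self, zero_mul]
  have := hmem v hv
  rwa [Subalgebra.coe_mul, ← mul_assoc] at this

theorem IsCut.raise {a c : ℕ} {γ : Γ} (h : IsCut n p V a c γ) (d : ℕ) :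
    ∃ δ : Γ, ∀ e, c ≤ e → e ≤ c * d → IsCut n p V a e (γ * δ) := by
  obtain ⟨δ, hδ⟩ : γ ∣ 1 - (1 - γ) ^ d := by
    have := sub_dvd_pow_sub_pow 1 (1 - γ) d
    simpa using this
  refine ⟨δ, fun e hce hed => ⟨h.pos.trans hce, ?_, fun v hv x hx => ?_⟩⟩
  · rw [← hδ, sub_sub_cancel]
    have := Ideal.pow_mem_pow h.one_sub d
    rw [← pow_mul] at this
    exact Ideal.pow_le_pow_right hed this
  · have h1 := idealSub_mul_right V (n ^ a) (h.mem v hv x (Ideal.pow_le_pow_right hce hx)) δ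
    have h2 : v * γ * x * δ = v * ((γ * δ : Γ) : U) * x := by
      have : (x : U) * δ = δ * x := congrArg Subtype.val (mul_comm x δ)
      rw [mul_assoc _ (x : U), this, Subalgebra.coe_mul, ← mul_assoc, ← mul_assoc]
    rwa [h2] at h1

theorem exists_isCut₂ [Algebra.FiniteType k Γ] [IsHarishChandra Γ] (n n' p : Ideal Γ)
    [n.IsMaximal] [n'.IsMaximal] (V V' : FGBimod Γ) (a a' : ℕ) :
    ∃ c γ, IsCut n p V a c γ ∧ IsCut n' p V' a' c γ := by
  obtain ⟨c, γ, h⟩ := exists_isCut n p V a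
  obtain ⟨c', γ', h'⟩ := exists_isCut n' p V' a'
  have hc := h.pos
  have hc' := h'.pos
  obtain ⟨δ, hδ⟩ := h.raise (c + c')
  obtain ⟨δ', hδ'⟩ := h'.raise (c + c')
  have h1 := hδ (c + c') (by omega) (by nlinarith)
  have h1' := hδ' (c + c') (by omega) (by nlinarith)
  generalize γ * δ = α at h1
  generalize γ' * δ' = β at h1'
  have hone : 1 - α * β ∈ p ^ (c + c') := by
    have : 1 - α * β = (1 - α) + α * (1 - β) := by ring
    rw [this]
    exact add_mem h1.one_sub (Ideal.mul_mem_left _ _ h1'.one_sub)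
  refine ⟨c + c', α * β, ⟨h1.pos, hone, fun v hv x hx => ?_⟩, ⟨h1.pos, hone, fun v hv x hx => ?_⟩⟩
  · have := h1.mem v hv (β * x) (Ideal.mul_mem_left _ _ hx)
    rwa [Subalgebra.coe_mul, ← mul_assoc, mul_assoc v, ← Subalgebra.coe_mul] at this
  · have := h1'.mem v hv (α * x) (Ideal.mul_mem_left _ _ hx)
    rwa [Subalgebra.coe_mul, ← mul_assoc, mul_assoc v, ← Subalgebra.coe_mul, mul_comm β α] at this

/-- Key fact: `v γ w` modulo `𝔫ᵃ T + T 𝔪ᵇ` does not depend on the choices. -/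
theorem cut_congr (hT : V.1 * W.1 ≤ T.1) {x : Completion n p V} {y : Completion p m W}
    {a b c c' : ℕ} {γ γ' : Γ} (h : IsCut n p V a c γ) (h' : IsCut n p V a c' γ') {v v' w w' : U}
    (hv : Rep x a c v) (hv' : Rep x a c' v') (hw : Rep y c b w) (hw' : Rep y c' b w') :
    v * γ * w - v' * γ' * w' ∈ filt n m T a b := by
  have hIT : idealSub (n ^ a) * V.1 * W.1 ≤ idealSub (n ^ a) * T.1 := by
    rw [mul_assoc]
    exact mul_le_mul' le_rfl hT
  have hTI : V.1 * (W.1 * idealSub (m ^ b)) ≤ T.1 * idealSub (m ^ b) := by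
    rw [← mul_assoc]
    exact mul_le_mul' hT le_rfl
  have comm : ∀ g g' : Γ, (g : U) * g' = g' * g := fun g g' => congrArg Subtype.val (mul_comm g g')
  -- dependence on the representatives
  have main : ∀ (c : ℕ) (γ : Γ), IsCut n p V a c γ → ∀ v v' w w', Rep x a c v → Rep x a c v' →
      Rep y c b w → Rep y c b w' → v * γ * w - v' * γ * w' ∈ filt n m T a b := by
    intro c γ h v v' w w' hv hv' hw hw'
    have e : v * γ * w - v' * γ * w' = (v - v') * γ * w + v' * γ * (w - w') := by noncomm_ring
    rw [e]
    refine add_mem ?_ ?_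
    · obtain ⟨r, hr, s, hs, hrs⟩ := Submodule.mem_sup.1 (hv.sub_mem hv')
      rw [← hrs, add_mul, add_mul]
      refine add_mem (Submodule.mem_sup_left (hIT (Submodule.mul_mem_mul
        (idealSub_mul_right V _ hr γ) hw.1))) (Submodule.mem_sup_left (hIT
          (Submodule.mul_mem_mul ?_ hw.1)))
      clear hrs
      induction hs using Submodule.mul_induction_on' with
      | mem_mul_mem v hv i hi =>
        obtain ⟨i, hi, rfl⟩ := hi
        change v * (i : U) * γ ∈ _
        rw [mul_assoc, comm, ← mul_assoc]
        exact h.mem v hv i hi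
      | add r _ s _ hr hs => rw [add_mul]; exact add_mem hr hs
    · obtain ⟨r, hr, s, hs, hrs⟩ := Submodule.mem_sup.1 (hw.sub_mem hw')
      rw [← hrs, mul_add]
      refine add_mem (Submodule.mem_sup_left (hIT ?_)) (Submodule.mem_sup_right (hTI
          (Submodule.mul_mem_mul (V.right_mem hv'.1 γ.2) hs)))
      clear hrs
      induction hr using Submodule.mul_induction_on' with
      | mem_mul_mem i hi w hw =>
        obtain ⟨i, hi, rfl⟩ := hi
        change v' * γ * ((i : U) * w) ∈ _
        rw [← mul_assoc]
        exact Submodule.mul_mem_mul (h.mem v' hv'.1 i hi) hw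
      | add r _ s _ hr hs => rw [mul_add]; exact add_mem hr hs
  -- `v γ (1 - γ') ∈ 𝔫ᵃ V` for any two cuts
  have key : ∀ (c c' : ℕ) (γ γ' : Γ), IsCut n p V a c γ → IsCut n p V a c' γ' →
      ∀ v ∈ V.1, v * γ * ((1 - γ' : Γ) : U) ∈ idealSub (n ^ a) * V.1 := by
    intro c c' γ γ' h h' v hv
    have hpow : ∀ i : ℕ, v * γ * ((1 - γ' : Γ) : U) - v * γ * (((1 - γ') ^ (i + 1) : Γ) : U) ∈
        idealSub (n ^ a) * V.1 := by
      intro i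
      induction i with
      | zero => simp
      | succ i ih =>
        have h1 : v * γ * (((1 - γ') ^ (i + 1) : Γ) : U) - v * γ * (((1 - γ') ^ (i + 2) : Γ) : U) ∈
            idealSub (n ^ a) * V.1 := by
          have hx : (1 - γ') ^ (i + 1) ∈ p ^ c' := by
            rw [pow_succ]
            exact Ideal.mul_mem_left _ _ h'.one_sub
          have h2 := h'.mem (v * γ) (V.right_mem hv γ.2) _ hx
          have e : (1 - γ') ^ (i + 1) - (1 - γ') ^ (i + 2) = γ' * (1 - γ') ^ (i + 1) := by ring
          rw [← mul_sub, ← Subalgebra.coe_sub, e, Subalgebra.coe_mul, ← mul_assoc]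
          exact h2
        have := add_mem ih h1
        rwa [sub_add_sub_cancel] at this
    have h3 : (1 - γ') ^ (c + 1) ∈ p ^ c := by
      have h4 := Ideal.pow_mem_pow h'.one_sub (c + 1)
      rw [← pow_mul] at h4
      have := h'.pos
      exact Ideal.pow_le_pow_right (by nlinarith) h4
    have := add_mem (hpow c) (h.mem v hv _ h3)
    rwa [sub_add_cancel] at this
  obtain ⟨v₀, hv₀⟩ := exists_rep x a (max c c')
  obtain ⟨w₀, hw₀⟩ := exists_rep y (max c c') b
  have hvc := hv₀.mono le_rfl (le_max_left c c')
  have hvc' := hv₀.mono le_rfl (le_max_right c c')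
  have hwc := hw₀.mono (le_max_left c c') le_rfl
  have hwc' := hw₀.mono (le_max_right c c') le_rfl
  have e1 := main c γ h v v₀ w w₀ hv hvc hw hwc
  have e2 := main c' γ' h' v₀ v' w₀ w' hvc' hv' hwc' hw'
  have e3 : v₀ * γ * w₀ - v₀ * γ' * w₀ ∈ filt n m T a b := by
    have e : v₀ * γ * w₀ - v₀ * γ' * w₀ =
        (v₀ * γ * ((1 - γ' : Γ) : U) - v₀ * γ' * ((1 - γ : Γ) : U)) * w₀ := by
      simp only [Subalgebra.coe_sub, Subalgebra.coe_one, mul_sub, mul_one, mul_assoc, comm γ γ']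
      noncomm_ring
    rw [e]
    exact Submodule.mem_sup_left (hIT (Submodule.mul_mem_mul
      (sub_mem (key c c' γ γ' h h' v₀ hv₀.1) (key c' c γ' γ h' h v₀ hv₀.1)) hw₀.1))
  have := add_mem (add_mem e1 e3) e2
  rwa [sub_add_sub_cancel, sub_add_sub_cancel] at this

variable [Algebra.FiniteType k Γ] [IsHarishChandra Γ]

section Comp

variable [n.IsMaximal]

/-- The product `lim V/(𝔫ᵃV + V𝔭ᶜ) × lim W/(𝔭ᶜW + W𝔪ᵇ) ⟶ lim T/(𝔫ᵃT + T𝔪ᵇ)` for `VW ⊆ T`: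
its component at `(a, b)` is the class of `v γ w`, where `γ ∈ Γ` acts on `V / 𝔫ᵃ V` as the
projection onto the `𝔭`-primary component, `c` is large, and `v`, `w` represent the components of
`x`, `y` at `(a, c)` and `(c, b)`. -/
noncomputable def compFun (hT : V.1 * W.1 ≤ T.1) (x : Completion n p V) (y : Completion p m W) :
    Completion n m T :=
  ⟨fun a b => filtMk n m T a b
      ⟨(exists_rep x a (exists_isCut n p V a).choose).choose *
          ((exists_isCut n p V a).choose_spec.choose : Γ) *
          (exists_rep y (exists_isCut n p V a).choose b).choose,
        mul_cut_mem hT (exists_rep x a _).choose_spec.1 _ (exists_rep y _ b).choose_spec.1⟩, by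
    intro a a' b b' ha hb
    refine (filtMk_eq_iff n m T a b _ _).2 ?_
    exact cut_congr hT ((exists_isCut n p V a').choose_spec.choose_spec.mono ha)
      (exists_isCut n p V a).choose_spec.choose_spec
      ((exists_rep x a' _).choose_spec.mono ha le_rfl) (exists_rep x a _).choose_spec
      ((exists_rep y _ b').choose_spec.mono le_rfl hb) (exists_rep y _ b).choose_spec⟩

theorem Rep.comp (hT : V.1 * W.1 ≤ T.1) {x : Completion n p V} {y : Completion p m W}
    {a b c : ℕ} {γ : Γ} (h : IsCut n p V a c γ) {v w : U} (hv : Rep x a c v) (hw : Rep y c b w) :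
    Rep (compFun hT x y) a b (v * γ * w) :=
  Rep.of_sub_mem (v := (exists_rep x a (exists_isCut n p V a).choose).choose *
          ((exists_isCut n p V a).choose_spec.choose : Γ) *
          (exists_rep y (exists_isCut n p V a).choose b).choose)
    ⟨_, rfl⟩ (mul_cut_mem hT hv.1 γ hw.1)
    (cut_congr hT (exists_isCut n p V a).choose_spec.choose_spec h (exists_rep x a _).choose_spec
      hv (exists_rep y _ b).choose_spec hw)

/-- The product as a bilinear map. -/
noncomputable def compLin (hT : V.1 * W.1 ≤ T.1) :
    Completion n p V →ₗ[k] Completion p m W →ₗ[k] Completion n m T :=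
  LinearMap.mk₂ k (compFun hT)
    (fun x x' y => ext_rep fun a b => by
      obtain ⟨c, γ, h⟩ := exists_isCut n p V a
      obtain ⟨v, hv⟩ := exists_rep x a c
      obtain ⟨v', hv'⟩ := exists_rep x' a c
      obtain ⟨w, hw⟩ := exists_rep y c b
      refine ⟨_, Rep.comp hT h (hv.add hv') hw, ?_⟩
      rw [add_mul, add_mul]
      exact (Rep.comp hT h hv hw).add (Rep.comp hT h hv' hw))
    (fun r x y => ext_rep fun a b => by
      obtain ⟨c, γ, h⟩ := exists_isCut n p V a
      obtain ⟨v, hv⟩ := exists_rep x a c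
      obtain ⟨w, hw⟩ := exists_rep y c b
      refine ⟨_, Rep.comp hT h (hv.smul r) hw, ?_⟩
      rw [smul_mul_assoc, smul_mul_assoc]
      exact (Rep.comp hT h hv hw).smul r)
    (fun x y y' => ext_rep fun a b => by
      obtain ⟨c, γ, h⟩ := exists_isCut n p V a
      obtain ⟨v, hv⟩ := exists_rep x a c
      obtain ⟨w, hw⟩ := exists_rep y c b
      obtain ⟨w', hw'⟩ := exists_rep y' c b
      refine ⟨_, Rep.comp hT h hv (hw.add hw'), ?_⟩
      rw [mul_add]
      exact (Rep.comp hT h hv hw).add (Rep.comp hT h hv hw'))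
    (fun r x y => ext_rep fun a b => by
      obtain ⟨c, γ, h⟩ := exists_isCut n p V a
      obtain ⟨v, hv⟩ := exists_rep x a c
      obtain ⟨w, hw⟩ := exists_rep y c b
      refine ⟨_, Rep.comp hT h hv (hw.smul r), ?_⟩
      rw [mul_smul_comm]
      exact (Rep.comp hT h hv hw).smul r)

end Comp

end Completion

namespace FinitaryCompletion

open Completion

variable {n m p q : Ideal Γ}

theorem of_eq_of_rep {V W : FGBimod Γ} (T : FGBimod Γ) (hV : V ≤ T) (hW : W ≤ T)
    {x : Completion n m V} {y : Completion n m W} (h : ∀ a b, ∃ v, Rep x a b v ∧ Rep y a b v) :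
    of n m V x = of n m W y := by
  rw [← of_trans n m hV, ← of_trans n m hW]
  congr 1
  refine ext_rep fun a b => ?_
  obtain ⟨v, h1, h2⟩ := h a b
  exact ⟨v, h1.trans hV, h2.trans hW⟩

variable [Algebra.FiniteType k Γ] [IsHarishChandra Γ] [n.IsMaximal]

/-- The product of finitary completions, with `V` fixed. -/
noncomputable def compAux (V : FGBimod Γ) :
    FinitaryCompletion p m →ₗ[k] Completion n p V →ₗ[k] FinitaryCompletion n m :=
  lift
    (fun W => ((compLin (le_refl (V.mul W).1)).compr₂ (of n m (V.mul W))).flip)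
    fun W W' h y => by
      refine LinearMap.ext fun x => ?_
      rw [LinearMap.flip_apply, LinearMap.flip_apply, LinearMap.compr₂_apply,
        LinearMap.compr₂_apply]
      refine of_eq_of_rep (V.mul W') le_rfl (FGBimod.mul_mono le_rfl h) fun a b => ?_
      obtain ⟨c, γ, hc⟩ := exists_isCut n p V a
      obtain ⟨v, hv⟩ := exists_rep x a c
      obtain ⟨w, hw⟩ := exists_rep y c b
      exact ⟨_, Rep.comp le_rfl hc hv (hw.trans h), Rep.comp le_rfl hc hv hw⟩

/-- The composition `𝒜(𝔭, 𝔫) × 𝒜(𝔪, 𝔭) ⟶ 𝒜(𝔪, 𝔫)`: the direct limit of the products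
for `V`, `W` and `T = VW`. -/
noncomputable def comp :
    FinitaryCompletion n p →ₗ[k] FinitaryCompletion p m →ₗ[k] FinitaryCompletion n m :=
  lift (fun V => (compAux V).flip)
    fun V V' h x => by
      refine LinearMap.ext fun y => ?_
      obtain ⟨W, y, rfl⟩ := exists_of y
      rw [LinearMap.flip_apply, LinearMap.flip_apply, compAux, compAux, lift_of, lift_of,
        LinearMap.flip_apply, LinearMap.flip_apply, LinearMap.compr₂_apply, LinearMap.compr₂_apply]
      refine of_eq_of_rep (V'.mul W) le_rfl (FGBimod.mul_mono h le_rfl) fun a b => ?_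
      obtain ⟨c, γ, hc, hc'⟩ := exists_isCut₂ n n p V V' a a
      obtain ⟨v, hv⟩ := exists_rep x a c
      obtain ⟨w, hw⟩ := exists_rep y c b
      exact ⟨_, Rep.comp le_rfl hc' (hv.trans h) hw, Rep.comp le_rfl hc hv hw⟩

theorem comp_of (V W : FGBimod Γ) (x : Completion n p V) (y : Completion p m W) :
    comp (of n p V x) (of p m W y) = of n m (V.mul W) (compLin le_rfl x y) := by
  rw [comp, lift_of, LinearMap.flip_apply, compAux, lift_of, LinearMap.flip_apply,
    LinearMap.compr₂_apply]

theorem comp_assoc [p.IsMaximal] (x : FinitaryCompletion n p) (y : FinitaryCompletion p q)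
    (z : FinitaryCompletion q m) : comp (comp x y) z = comp x (comp y z) := by
  obtain ⟨V, x, rfl⟩ := exists_of x
  obtain ⟨W, y, rfl⟩ := exists_of y
  obtain ⟨Z, z, rfl⟩ := exists_of z
  rw [comp_of, comp_of, comp_of, comp_of]
  refine of_eq_of_rep ((V.mul W).mul Z) le_rfl (mul_assoc V.1 W.1 Z.1).ge fun a b => ?_
  obtain ⟨e, γ, he⟩ := exists_isCut n p V a
  obtain ⟨c, δ, hc, hc'⟩ := exists_isCut₂ n p q (V.mul W) W a e
  obtain ⟨v, hv⟩ := exists_rep x a e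
  obtain ⟨w, hw⟩ := exists_rep y e c
  obtain ⟨t, ht⟩ := exists_rep z c b
  refine ⟨_, Rep.comp le_rfl hc (Rep.comp le_rfl he hv hw) ht, ?_⟩
  have e : v * γ * w * δ * t = v * γ * (w * δ * t) := by simp only [mul_assoc]
  rw [e]
  exact Rep.comp le_rfl he hv (Rep.comp le_rfl hc' hw ht)

theorem one_comp (y : FinitaryCompletion n m) : comp (image n n 1) y = y := by
  obtain ⟨W, y, rfl⟩ := exists_of y
  rw [image, comp_of]
  obtain ⟨T, h1, h2⟩ := exists_ge_ge ((FGBimod.gen Γ 1).mul W) W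
  refine of_eq_of_rep T h1 h2 fun a b => ?_
  obtain ⟨c, γ, hc⟩ := exists_isCut n n (FGBimod.gen Γ 1) a
  obtain ⟨δ, hδ⟩ := hc.raise (a + 1)
  have := hc.pos
  have he := hδ (c * (a + 1)) (by nlinarith) le_rfl
  have hae : a ≤ c * (a + 1) := by nlinarith
  obtain ⟨w, hw⟩ := exists_rep y (c * (a + 1)) b
  refine ⟨_, Rep.comp le_rfl he (v := 1) ⟨FGBimod.mem_gen 1, rfl⟩ hw, ?_⟩
  have hw' := hw.mono hae le_rfl
  rw [one_mul]
  refine hw'.of_sub_mem (W.left_mem (γ * δ).2 hw.1) (Submodule.mem_sup_left ?_)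
  have h3 := Submodule.mul_mem_mul
    (mem_idealSub (k := k) (Ideal.pow_le_pow_right hae he.one_sub)) hw.1
  rwa [Subalgebra.coe_sub, Subalgebra.coe_one, sub_mul, one_mul] at h3

theorem comp_one (x : FinitaryCompletion n p) : comp x (image p p 1) = x := by
  obtain ⟨V, x, rfl⟩ := exists_of x
  rw [image, comp_of]
  obtain ⟨T, h1, h2⟩ := exists_ge_ge (V.mul (FGBimod.gen Γ 1)) V
  refine of_eq_of_rep T h1 h2 fun a b => ?_
  obtain ⟨c, γ, hc⟩ := exists_isCut n p V a
  obtain ⟨δ, hδ⟩ := hc.raise (b + 1)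
  have := hc.pos
  have he := hδ (c * (b + 1)) (by nlinarith) le_rfl
  have hbe : b ≤ c * (b + 1) := by nlinarith
  obtain ⟨v, hv⟩ := exists_rep x a (c * (b + 1))
  refine ⟨_, Rep.comp le_rfl he (w := 1) hv ⟨FGBimod.mem_gen 1, rfl⟩, ?_⟩
  have hv' := hv.mono le_rfl hbe
  rw [mul_one]
  refine hv'.of_sub_mem (V.right_mem hv.1 (γ * δ).2) (Submodule.mem_sup_right ?_)
  have h3 := Submodule.mul_mem_mul hv.1
    (mem_idealSub (k := k) (Ideal.pow_le_pow_right hbe he.one_sub))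
  rwa [Subalgebra.coe_sub, Subalgebra.coe_one, mul_sub, mul_one] at h3

end FinitaryCompletion

/-! ### The category `𝒜` -/

variable (Γ) in
/-- The objects of the category `𝒜`: the maximal ideals of `Γ`. -/
def PierceCat : Type u := MaximalSpectrum Γ

namespace PierceCat

/-- The maximal ideal underlying an object. -/
def ideal (m : PierceCat Γ) : Ideal Γ := MaximalSpectrum.asIdeal m

instance (m : PierceCat Γ) : m.ideal.IsMaximal := MaximalSpectrum.isMaximal m

variable [Algebra.FiniteType k Γ] [IsHarishChandra Γ]

/-- The category `𝒜`, with `𝒜(𝔪, 𝔫)` the finitary completion of `U` at `(𝔫, 𝔪)`. -/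
noncomputable instance : Category.{u} (PierceCat Γ) where
  Hom m n := FinitaryCompletion n.ideal m.ideal
  id m := FinitaryCompletion.image m.ideal m.ideal 1
  comp f g := FinitaryCompletion.comp g f
  id_comp f := FinitaryCompletion.comp_one f
  comp_id f := FinitaryCompletion.one_comp f
  assoc f g h := (FinitaryCompletion.comp_assoc h g f).symm

noncomputable instance : Preadditive (PierceCat Γ) where
  homGroup m n := inferInstanceAs (AddCommGroup (FinitaryCompletion n.ideal m.ideal))
  add_comp P _ _ f f' g := LinearMap.map_add (FinitaryCompletion.comp (m := P.ideal) g) f f'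
  comp_add P Q R f g g' := LinearMap.map_add₂ (FinitaryCompletion.comp (n := R.ideal)
    (p := Q.ideal) (m := P.ideal)) g g' f

noncomputable instance : Linear k (PierceCat Γ) where
  homModule m n := inferInstanceAs (Module k (FinitaryCompletion n.ideal m.ideal))
  smul_comp P _ _ r f g := LinearMap.map_smul (FinitaryCompletion.comp (m := P.ideal) g) r f
  comp_smul P Q R f r g := LinearMap.map_smul₂ (FinitaryCompletion.comp (n := R.ideal)
    (p := Q.ideal) (m := P.ideal)) r g f

/-- The morphism spaces of `𝒜` carry the direct limit (over `V`) of the inverse limit topologies. -/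
noncomputable instance (m n : PierceCat Γ) : TopologicalSpace (m ⟶ n) :=
  inferInstanceAs (TopologicalSpace (FinitaryCompletion n.ideal m.ideal))

/-- The image of `u ∈ U` in `𝒜(𝔪, 𝔫)`. -/
noncomputable def image (m n : PierceCat Γ) (u : U) : m ⟶ n :=
  FinitaryCompletion.image n.ideal m.ideal u

/-- `(𝔪, 𝔫) ∈ X_u`: with `V = Γ u Γ`, the space `V / (𝔫 V + V 𝔪) = Γ/𝔫 ⊗ V ⊗ Γ/𝔪` is nonzero. -/
def Linked (u : U) (m n : PierceCat Γ) : Prop :=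
  Nontrivial (filtQuot n.ideal m.ideal (FGBimod.gen Γ u) 1 1)

variable (Γ) in
/-- The equivalence relation `Δ` on the maximal ideals of `Γ` generated by all `X_u`, `u ∈ U`. -/
def linkage : Setoid (PierceCat Γ) := Relation.EqvGen.setoid fun m n => ∃ u, Linked u m n

end PierceCat

end GelfandTsetlin

/-!
For a finitely generated `Γ`-bimodule `V`, the annihilator `J` of the right `Γ`-module
`V / 𝔫 V` has finite codimension in `Γ`, because `V` is finitely generated as a left module. If
`J ⊄ 𝔪`, then `J + 𝔪 = Γ`, hence `V = 𝔫 V + V 𝔪` and the completion of `V` at `(𝔫, 𝔪)` vanishes.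
Since only finitely many maximal ideals contain `J`, the rows of `[u]` are finite; the columns are
treated symmetrically. Modulo `𝔫ᵃ V` the projections onto the primary components of `V / 𝔫ᵃ V`
at the maximal ideals containing `J` add up to the identity, which is the multiplicativity
`[u v] = [u] [v]`.

For the density, finitely many entries of a matrix in `M_D` all come from the completions of one
bimodule `V`. The Chinese remainder theorem on the left and on the right of `V` yields a single
element of `V` which agrees with all of these entries modulo `𝔫ᵇ V + V 𝔪ᵇ`, and then `b → ∞`.
-/

section Ideals

variable {A ι : Type*} [CommRing A]

theorem finite_setOf_le_asIdeal (J : Ideal A) [IsArtinianRing (A ⧸ J)] :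
    {P : MaximalSpectrum A | J ≤ P.asIdeal}.Finite := by
  have hJ : (PrimeSpectrum.zeroLocus (J : Set A)).Finite := by
    rw [← Ideal.mk_ker (I := J),
      ← range_comap_of_surjective _ _ Ideal.Quotient.mk_surjective]
    exact Set.finite_range _
  exact hJ.preimage MaximalSpectrum.toPrimeSpectrum_injective.injOn

theorem mul_mem_of_isCoprime {I I' J : Ideal A} (h : IsCoprime I I') {x y : A}
    (hx : ∀ z ∈ I, x * z ∈ J) (hy : ∀ z ∈ I', y * z ∈ J) : x * y ∈ J := by
  obtain ⟨i, hi, i', hi', hii'⟩ := Ideal.isCoprime_iff_exists.1 h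
  have hxy : x * y = y * (x * i) + x * (y * i') := by linear_combination -(x * y) * hii'
  rw [hxy]
  exact add_mem (J.mul_mem_left _ (hx i hi)) (J.mul_mem_left _ (hy i' hi'))

theorem mul_one_sub_sum_mem_of_pairwise_isCoprime {J : Ideal A} {I : ι → Ideal A} {e : ι → A}
    {s : Finset ι} (hI : (s : Set ι).Pairwise fun i j => IsCoprime (I i) (I j))
    (he : ∀ i ∈ s, 1 - e i ∈ I i) (heJ : ∀ i ∈ s, ∀ x ∈ I i, e i * x ∈ J) {i : ι} (hi : i ∈ s) :
    e i * (1 - ∑ j ∈ s, e j) ∈ J := by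
  classical
  have hsplit : e i * (1 - ∑ j ∈ s, e j) = e i * (1 - e i) - ∑ j ∈ s.erase i, e i * e j := by
    rw [← Finset.mul_sum, ← mul_sub, sub_sub, Finset.add_sum_erase s e hi]
  rw [hsplit]
  refine sub_mem (heJ i hi _ (he i hi)) (sum_mem fun j hj => ?_)
  obtain ⟨hji, hj⟩ := Finset.mem_erase.1 hj
  exact mul_mem_of_isCoprime (hI hi hj hji.symm) (heJ i hi) (heJ j hj)

-- The ideal of all `x` with `x * (1 - ∑ e i) ∈ J` contains `J` and every `e i`, hence lies in no
-- maximal ideal.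
theorem one_sub_sum_mem_of_pairwise_isCoprime {J : Ideal A} {I : ι → Ideal A} {e : ι → A}
    {s : Finset ι} (hI : (s : Set ι).Pairwise fun i j => IsCoprime (I i) (I j))
    (he : ∀ i ∈ s, 1 - e i ∈ I i) (heJ : ∀ i ∈ s, ∀ x ∈ I i, e i * x ∈ J)
    (hs : ∀ M : Ideal A, M.IsMaximal → J ≤ M → ∃ i ∈ s, I i ≤ M) : 1 - ∑ i ∈ s, e i ∈ J := by
  suffices htop : J.colon {1 - ∑ i ∈ s, e i} = ⊤ by
    simpa using Submodule.mem_colon_singleton.1 ((Ideal.eq_top_iff_one _).1 htop)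
  by_contra hne
  obtain ⟨M, hM, hle⟩ := Ideal.exists_le_maximal _ hne
  obtain ⟨i, hi, hiM⟩ := hs M hM fun x hx =>
    hle (Submodule.mem_colon_singleton.2 (J.mul_mem_right _ hx))
  have heM : e i ∈ M := hle <| Submodule.mem_colon_singleton.2 <|
    mul_one_sub_sum_mem_of_pairwise_isCoprime hI he heJ hi
  refine hM.ne_top ((Ideal.eq_top_iff_one _).2 ?_)
  rw [← sub_add_cancel 1 (e i)]
  exact add_mem (hiM (he i hi)) heM

end Ideals

theorem le_pow_mul_add_mul_pow {R : Type*} [IdemSemiring R] {x y v : R} (hx : x * v ≤ v)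
    (hy : v * y ≤ v) (h : v ≤ x * v + v * y) (a b : ℕ) : v ≤ x ^ a * v + v * y ^ b := by
  have hleft : v ≤ x ^ a * v + v * y := by
    induction a with
    | zero => simp
    | succ a ih =>
      calc v ≤ x * v + v * y := h
        _ ≤ x * (x ^ a * v + v * y) + v * y := by gcongr
        _ = x ^ (a + 1) * v + (x * v * y + v * y) := by
          rw [pow_succ', mul_add, add_assoc, mul_assoc, mul_assoc]
        _ ≤ x ^ (a + 1) * v + (v * y + v * y) := by gcongr
        _ = x ^ (a + 1) * v + v * y := by rw [add_idem]
  induction b with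
  | zero => simp
  | succ b ih =>
    calc v ≤ x ^ a * v + v * y := hleft
      _ ≤ x ^ a * v + (x ^ a * v + v * y ^ b) * y := by gcongr
      _ = (x ^ a * v + x ^ a * (v * y)) + v * y ^ (b + 1) := by
        rw [pow_succ, add_mul, add_assoc, mul_assoc, mul_assoc]
      _ ≤ (x ^ a * v + x ^ a * v) + v * y ^ (b + 1) := by gcongr
      _ = x ^ a * v + v * y ^ (b + 1) := by rw [add_idem]

section FiniteDimensional

variable {k M : Type*} [Field k] [AddCommGroup M] [Module k M] {V N : Submodule k M}

theorem finite_quotient_submoduleOf {C : Submodule k M} (hC : C.FG) (h : V ≤ N ⊔ C) :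
    Module.Finite k (V ⧸ N.submoduleOf V) := by
  have hle : V.map N.mkQ ≤ C.map N.mkQ := by
    simpa using Submodule.map_mono (f := N.mkQ) h
  have : Module.Finite k (C.map N.mkQ) := Module.Finite.iff_fg.2 (hC.map N.mkQ)
  let f : V →ₗ[k] C.map N.mkQ := (N.mkQ ∘ₗ V.subtype).codRestrict _ fun v =>
    hle (Submodule.mem_map_of_mem v.2)
  have hf : LinearMap.ker f = N.submoduleOf V := by
    rw [LinearMap.ker_codRestrict, LinearMap.ker_comp, Submodule.ker_mkQ]
    rfl
  exact Module.Finite.equiv ((Submodule.quotEquivOfEq _ _ hf.symm).trans f.quotKerEquivRange).symm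

theorem finite_quotient_of_mem_iff [Module.Finite k (V ⧸ N.submoduleOf V)] {A : Type*}
    [AddCommGroup A] [Module k A] (L : A →ₗ[k] Module.End k M) (hV : ∀ a, ∀ v ∈ V, L a v ∈ V)
    (hN : ∀ a, ∀ v ∈ N, L a v ∈ N) {J : Submodule k A}
    (hJ : ∀ a, a ∈ J ↔ ∀ v ∈ V, L a v ∈ N) : Module.Finite k (A ⧸ J) := by
  let φ : A →ₗ[k] Module.End k (V ⧸ N.submoduleOf V) :=
    { toFun := fun a => Submodule.mapQ _ _ ((L a).restrict (hV a)) fun _ hx => hN a _ hx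
      map_add' := fun a b => by
        ext v
        exact congrArg (N.submoduleOf V).mkQ (Subtype.ext (by simp))
      map_smul' := fun c a => by
        ext v
        exact congrArg (N.submoduleOf V).mkQ (Subtype.ext (by simp)) }
  have hφ : LinearMap.ker φ = J := by
    ext a
    have hmk (v : V) : φ a (Submodule.Quotient.mk v) = 0 ↔ L a v ∈ N :=
      Submodule.Quotient.mk_eq_zero (N.submoduleOf V)
    rw [hJ]
    refine ⟨fun ha v hv => (hmk ⟨v, hv⟩).1 (LinearMap.congr_fun ha _), fun ha => ?_⟩
    ext v
    exact (hmk v).2 (ha v v.2)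
  exact Module.Finite.equiv ((Submodule.quotEquivOfEq _ _ hφ.symm).trans φ.quotKerEquivRange).symm

end FiniteDimensional

section Topology

open Filter Topology

theorem mem_closure_range_of_forall_finset_tendsto {α ι : Type*} {Z : ι → Type*}
    [∀ i, TopologicalSpace (Z i)] {f : α → ∀ i, Z i} {z : ∀ i, Z i}
    (h : ∀ s : Finset ι, ∃ l : Filter α, l.NeBot ∧ ∀ i ∈ s, Tendsto (f · i) l (𝓝 (z i))) :
    z ∈ closure (Set.range f) := by
  refine mem_closure_iff.2 fun O hO hz => ?_
  obtain ⟨s, P, hP, hPO⟩ := isOpen_pi_iff.1 hO z hz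
  obtain ⟨l, _, hl⟩ := h s
  have hev : ∀ᶠ a in l, ∀ i ∈ s, f a i ∈ P i :=
    (eventually_all_finset s).2 fun i hi => hl i hi ((hP i hi).1.mem_nhds (hP i hi).2)
  obtain ⟨a, ha⟩ := hev.exists
  exact ⟨f a, hPO ha, a, rfl⟩

end Topology

namespace RCFMatrix

variable {k C I : Type*} [Field k] [Category C] [Preadditive C] [Linear k C] {X : I → C}
  [∀ i j, TopologicalSpace (X j ⟶ X i)]

theorem isInducing_entries :
    Topology.IsInducing fun (F : RCFMatrix k X) (p : I × I) => F.1 p.1 p.2 := by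
  refine ⟨?_⟩
  simp only [instTopologicalSpaceSubtype, Pi.topologicalSpace, induced_iInf, induced_compose,
    iInf_prod]
  rfl

end RCFMatrix

section GelfandTsetlin

variable {k : Type w} {U : Type u} [Field k] [Ring U] [Algebra k U] {Γ : Subalgebra k U}

namespace FGBimod

theorem gen_le {V : FGBimod Γ} {v : U} (hv : v ∈ V.1) : gen Γ v ≤ V := by
  refine Submodule.mul_le.2 fun x hx g hg => V.right_mem ?_ hg
  refine (Submodule.mul_le (P := V.1)).2 (fun g hg w hw => V.left_mem hg ?_) hx
  exact (Submodule.span_singleton_le_iff_mem v V.1).2 hv hw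

theorem exists_right_fg [IsHarishChandra Γ] (V : FGBimod Γ) :
    ∃ S : Finset U, V.1 = Submodule.span k S * Γ.toSubmodule := by
  classical
  obtain ⟨V, S, rfl⟩ := V
  induction S using Finset.induction with
  | empty => exact ⟨∅, by simp⟩
  | insert u S _ ih =>
    obtain ⟨T, hT⟩ := ih
    obtain ⟨T', hT'⟩ := IsHarishChandra.right_fg (Γ := Γ) u
    refine ⟨T' ∪ T, ?_⟩
    simp only at hT ⊢
    rw [Finset.coe_insert, Submodule.span_insert, Submodule.mul_sup, Submodule.sup_mul, hT, hT',
      Finset.coe_union, Submodule.span_union, Submodule.sup_mul]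

theorem toSubmodule_mul (V : FGBimod Γ) : Γ.toSubmodule * V.1 = V.1 := by
  obtain ⟨V, S, rfl⟩ := V
  rw [← mul_assoc, ← mul_assoc, (Subalgebra.isIdempotentElem_toSubmodule Γ).eq]

theorem mul_toSubmodule (V : FGBimod Γ) : V.1 * Γ.toSubmodule = V.1 := by
  obtain ⟨V, S, rfl⟩ := V
  rw [mul_assoc, (Subalgebra.isIdempotentElem_toSubmodule Γ).eq]

end FGBimod

theorem idealSub_top : idealSub (⊤ : Ideal Γ) = Γ.toSubmodule := by
  ext x
  simp [idealSub]

theorem idealSub_le (I : Ideal Γ) : idealSub I ≤ Γ.toSubmodule :=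
  idealSub_top.subst (motive := (idealSub I ≤ ·)) (idealSub_mono le_top)

theorem idealSub_mul_le (I : Ideal Γ) (V : FGBimod Γ) : idealSub I * V.1 ≤ V.1 :=
  (mul_le_mul' (idealSub_le I) le_rfl).trans V.toSubmodule_mul.le

theorem mul_idealSub_le (I : Ideal Γ) (V : FGBimod Γ) : V.1 * idealSub I ≤ V.1 :=
  (mul_le_mul' le_rfl (idealSub_le I)).trans V.mul_toSubmodule.le

theorem idealSub_mul_left (V : FGBimod Γ) (I : Ideal Γ) {y : U} (hy : y ∈ V.1 * idealSub I)
    (g : Γ) : (g : U) * y ∈ V.1 * idealSub I := by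
  rw [← V.toSubmodule_mul, mul_assoc]
  exact Submodule.mul_mem_mul g.2 hy

/-- The annihilator of the right `Γ`-module `V / I V`. -/
def rightAnn (I : Ideal Γ) (V : FGBimod Γ) : Ideal Γ where
  carrier := {γ | ∀ v ∈ V.1, v * γ ∈ idealSub I * V.1}
  add_mem' {x y} hx hy v hv := by
    rw [Subalgebra.coe_add, mul_add]
    exact add_mem (hx v hv) (hy v hv)
  zero_mem' v _ := by simp
  smul_mem' c x hx v hv := by
    rw [smul_eq_mul, Subalgebra.coe_mul, ← mul_assoc]
    exact hx _ (V.right_mem hv c.2)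

/-- The annihilator of the left `Γ`-module `V / V I`. -/
def leftAnn (I : Ideal Γ) (V : FGBimod Γ) : Ideal Γ where
  carrier := {γ | ∀ v ∈ V.1, (γ : U) * v ∈ V.1 * idealSub I}
  add_mem' {x y} hx hy v hv := by
    rw [Subalgebra.coe_add, add_mul]
    exact add_mem (hx v hv) (hy v hv)
  zero_mem' v _ := by simp
  smul_mem' c x hx v hv := by
    rw [smul_eq_mul, Subalgebra.coe_mul, mul_assoc]
    exact idealSub_mul_left V I (hx v hv) c

theorem le_rightAnn_iff {I K : Ideal Γ} {V : FGBimod Γ} :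
    K ≤ rightAnn I V ↔ V.1 * idealSub K ≤ idealSub I * V.1 := by
  refine ⟨fun h => Submodule.mul_le.2 ?_,
    fun h γ hγ v hv => h (Submodule.mul_mem_mul hv (mem_idealSub hγ))⟩
  rintro v hv _ ⟨γ, hγ, rfl⟩
  exact h hγ v hv

variable [IsMulCommutative Γ]

theorem idealSub_mul (I J : Ideal Γ) : idealSub (k := k) (I * J) = idealSub I * idealSub J := by
  rw [idealSub, Submodule.restrictScalars_mul, Submodule.map_mul]
  rfl

theorem idealSub_pow_le (I : Ideal Γ) (a : ℕ) : idealSub (k := k) I ^ a ≤ idealSub (I ^ a) := by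
  induction a with
  | zero =>
    rw [pow_zero, pow_zero, Ideal.one_eq_top, idealSub_top]
    exact Submodule.one_le.2 Γ.one_mem
  | succ a ih =>
    rw [pow_succ, pow_succ, idealSub_mul]
    exact mul_le_mul' ih le_rfl

theorem rightAnn_mul_rightAnn_le (I J : Ideal Γ) (V : FGBimod Γ) :
    rightAnn I V * rightAnn J V ≤ rightAnn (I * J) V := by
  refine le_rightAnn_iff.2 ?_
  calc V.1 * idealSub (rightAnn I V * rightAnn J V)
      = V.1 * idealSub (rightAnn I V) * idealSub (rightAnn J V) := by
        rw [idealSub_mul, mul_assoc]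
    _ ≤ idealSub I * V.1 * idealSub (rightAnn J V) :=
        mul_le_mul' (le_rightAnn_iff.1 le_rfl) le_rfl
    _ = idealSub I * (V.1 * idealSub (rightAnn J V)) := mul_assoc ..
    _ ≤ idealSub I * (idealSub J * V.1) := mul_le_mul' le_rfl (le_rightAnn_iff.1 le_rfl)
    _ = idealSub (I * J) * V.1 := by rw [idealSub_mul, mul_assoc]

theorem rightAnn_pow_le (I : Ideal Γ) (V : FGBimod Γ) (a : ℕ) :
    rightAnn I V ^ a ≤ rightAnn (I ^ a) V := by
  induction a with
  | zero =>
    refine le_rightAnn_iff.2 ?_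
    rw [pow_zero, pow_zero, Ideal.one_eq_top, idealSub_top, V.mul_toSubmodule, V.toSubmodule_mul]
  | succ a ih =>
    rw [pow_succ, pow_succ]
    exact (mul_le_mul' ih le_rfl).trans (rightAnn_mul_rightAnn_le _ _ _)

theorem Completion.IsCut.mul_mem_rightAnn {n p : Ideal Γ} {V : FGBimod Γ} {a c : ℕ} {γ : Γ}
    (h : IsCut n p V a c γ) {x : Γ} (hx : x ∈ p ^ c) :
    γ * x ∈ rightAnn (n ^ a) V := fun v hv => by
  rw [Subalgebra.coe_mul, ← mul_assoc]
  exact h.mem v hv x hx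

theorem le_filt_of_le_filt_one {n m : Ideal Γ} {V : FGBimod Γ} (h : V.1 ≤ filt n m V 1 1)
    (a b : ℕ) : V.1 ≤ filt n m V a b := by
  rw [filt, pow_one, pow_one] at h
  exact (le_pow_mul_add_mul_pow (idealSub_mul_le n V) (mul_idealSub_le m V) h a b).trans
    (sup_le_sup (mul_le_mul' (idealSub_pow_le n a) le_rfl)
      (mul_le_mul' le_rfl (idealSub_pow_le m b)))

theorem le_filt_one_of_rightAnn_sup_eq_top {n m : Ideal Γ} {V : FGBimod Γ}
    (h : rightAnn n V ⊔ m = ⊤) : V.1 ≤ filt n m V 1 1 := by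
  intro v hv
  obtain ⟨j, hj, x, hx, hjx⟩ := Submodule.mem_sup.1 ((Ideal.eq_top_iff_one _).1 h)
  have hsplit : v = v * j + v * x := by
    rw [← mul_add, ← Subalgebra.coe_add, hjx, Subalgebra.coe_one, mul_one]
  rw [hsplit, filt, pow_one, pow_one]
  exact Submodule.add_mem_sup (hj v hv) (Submodule.mul_mem_mul hv (mem_idealSub hx))

theorem le_filt_one_of_sup_leftAnn_eq_top {n m : Ideal Γ} {V : FGBimod Γ}
    (h : n ⊔ leftAnn m V = ⊤) : V.1 ≤ filt n m V 1 1 := by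
  intro v hv
  obtain ⟨x, hx, j, hj, hxj⟩ := Submodule.mem_sup.1 ((Ideal.eq_top_iff_one _).1 h)
  have hsplit : v = x * v + j * v := by
    rw [← add_mul, ← Subalgebra.coe_add, hxj, Subalgebra.coe_one, one_mul]
  rw [hsplit, filt, pow_one, pow_one]
  exact Submodule.add_mem_sup (Submodule.mul_mem_mul (mem_idealSub hx) hv) (hj v hv)

section Finiteness

variable [Algebra.FiniteType k Γ] [IsHarishChandra Γ]

theorem FGBimod.exists_fg_le_idealSub_mul_sup (n : Ideal Γ) [n.IsMaximal] (V : FGBimod Γ) :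
    ∃ C : Submodule k U, C.FG ∧ V.1 ≤ idealSub n * V.1 ⊔ C := by
  obtain ⟨S, hS⟩ := V.exists_left_fg
  obtain ⟨C, hC, hΓ⟩ := Completion.exists_fg_sup_eq_top (k := k) n 1
  have hS' : Submodule.span k (S : Set U) ≤ V.1 := by
    rw [hS]
    exact (one_mul _).symm.le.trans (mul_le_mul' (Submodule.one_le.2 Γ.one_mem) le_rfl)
  refine ⟨C * Submodule.span k S, hC.mul (Submodule.fg_span S.finite_toSet), ?_⟩
  have hΓS := hS.le.trans (mul_le_mul' hΓ le_rfl)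
  rw [Submodule.sup_mul, pow_one] at hΓS
  exact hΓS.trans (sup_le_sup_right (mul_le_mul' le_rfl hS') _)

theorem FGBimod.exists_fg_le_mul_idealSub_sup (m : Ideal Γ) [m.IsMaximal] (V : FGBimod Γ) :
    ∃ C : Submodule k U, C.FG ∧ V.1 ≤ V.1 * idealSub m ⊔ C := by
  obtain ⟨S, hS⟩ := V.exists_right_fg
  obtain ⟨C, hC, hΓ⟩ := Completion.exists_fg_sup_eq_top (k := k) m 1
  have hS' : Submodule.span k (S : Set U) ≤ V.1 := by
    rw [hS]
    exact (mul_one _).symm.le.trans (mul_le_mul' le_rfl (Submodule.one_le.2 Γ.one_mem))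
  refine ⟨Submodule.span k S * C, (Submodule.fg_span S.finite_toSet).mul hC, ?_⟩
  have hSΓ := hS.le.trans (mul_le_mul' le_rfl hΓ)
  rw [Submodule.mul_sup, pow_one] at hSΓ
  exact hSΓ.trans (sup_le_sup_right (mul_le_mul' hS' le_rfl) _)

theorem finite_quotient_rightAnn (n : Ideal Γ) [n.IsMaximal] (V : FGBimod Γ) :
    Module.Finite k (Γ ⧸ rightAnn n V) := by
  obtain ⟨C, hC, hVC⟩ := V.exists_fg_le_idealSub_mul_sup n
  have := finite_quotient_submoduleOf hC hVC
  let R : Γ →ₗ[k] Module.End k U := (LinearMap.mul k U).flip ∘ₗ Γ.val.toLinearMap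
  have hV (γ : Γ) : ∀ v ∈ V.1, R γ v ∈ V.1 := fun v hv => V.right_mem hv γ.2
  have hN (γ : Γ) : ∀ y ∈ idealSub n * V.1, R γ y ∈ idealSub n * V.1 :=
    fun y hy => idealSub_mul_right V n hy γ
  have hJ (γ : Γ) : γ ∈ (rightAnn n V).restrictScalars k ↔
      ∀ v ∈ V.1, R γ v ∈ idealSub n * V.1 := Iff.rfl
  have := finite_quotient_of_mem_iff R hV hN hJ
  exact Module.Finite.equiv (Submodule.Quotient.restrictScalarsEquiv k (rightAnn n V))

theorem finite_quotient_leftAnn (m : Ideal Γ) [m.IsMaximal] (V : FGBimod Γ) :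
    Module.Finite k (Γ ⧸ leftAnn m V) := by
  obtain ⟨C, hC, hVC⟩ := V.exists_fg_le_mul_idealSub_sup m
  have := finite_quotient_submoduleOf hC hVC
  let L : Γ →ₗ[k] Module.End k U := LinearMap.mul k U ∘ₗ Γ.val.toLinearMap
  have hV (γ : Γ) : ∀ v ∈ V.1, L γ v ∈ V.1 := fun v hv => V.left_mem γ.2 hv
  have hN (γ : Γ) : ∀ y ∈ V.1 * idealSub m, L γ y ∈ V.1 * idealSub m :=
    fun y hy => idealSub_mul_left V m hy γ
  have hJ (γ : Γ) : γ ∈ (leftAnn m V).restrictScalars k ↔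
      ∀ v ∈ V.1, L γ v ∈ V.1 * idealSub m := Iff.rfl
  have := finite_quotient_of_mem_iff L hV hN hJ
  exact Module.Finite.equiv (Submodule.Quotient.restrictScalarsEquiv k (leftAnn m V))

theorem finite_rightAnn_le (n : Ideal Γ) [n.IsMaximal] (V : FGBimod Γ) :
    {p : PierceCat Γ | rightAnn n V ≤ p.ideal}.Finite := by
  have := finite_quotient_rightAnn n V
  have := IsArtinianRing.of_finite k (Γ ⧸ rightAnn n V)
  exact finite_setOf_le_asIdeal (rightAnn n V)

theorem finite_leftAnn_le (n : Ideal Γ) [n.IsMaximal] (V : FGBimod Γ) :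
    {p : PierceCat Γ | leftAnn n V ≤ p.ideal}.Finite := by
  have := finite_quotient_leftAnn n V
  have := IsArtinianRing.of_finite k (Γ ⧸ leftAnn n V)
  exact finite_setOf_le_asIdeal (leftAnn n V)

end Finiteness

theorem PierceCat.isCoprime_of_ne {m n : PierceCat Γ} (h : m ≠ n) : IsCoprime m.ideal n.ideal :=
  Ideal.isCoprime_iff_sup_eq.2 <| Ideal.IsMaximal.coprime_of_ne m.isMaximal n.isMaximal
    fun e => h (MaximalSpectrum.ext e)

theorem one_sub_sum_mem_rightAnn {n : Ideal Γ} {V : FGBimod Γ} {a : ℕ} {c : PierceCat Γ → ℕ}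
    {γ : PierceCat Γ → Γ} (h : ∀ p, Completion.IsCut n p.ideal V a (c p) (γ p))
    {s : Finset (PierceCat Γ)} (hs : ∀ p : PierceCat Γ, rightAnn n V ≤ p.ideal → p ∈ s) :
    1 - ∑ p ∈ s, γ p ∈ rightAnn (n ^ a) V := by
  refine one_sub_sum_mem_of_pairwise_isCoprime (I := fun p => p.ideal ^ c p)
    (fun p _ q _ hpq => (PierceCat.isCoprime_of_ne hpq).pow) (fun p _ => (h p).one_sub)
    (fun p _ x hx => (h p).mul_mem_rightAnn hx) fun M hM hJM => ?_
  have hM' : rightAnn n V ≤ M := hM.isPrime.le_of_pow_le ((rightAnn_pow_le n V a).trans hJM)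
  exact ⟨⟨M, hM⟩, hs ⟨M, hM⟩ hM', Ideal.pow_le_self (Nat.one_le_iff_ne_zero.1 (h ⟨M, hM⟩).pos)⟩

namespace Completion

variable {n m : Ideal Γ} {V : FGBimod Γ}

theorem rep_const {v : U} (hv : v ∈ V.1) (a b : ℕ) : Rep (const n m v hv) a b v := ⟨hv, rfl⟩

theorem rep_zero (a b : ℕ) : Rep (0 : Completion n m V) a b 0 :=
  ⟨zero_mem _, map_zero (filtMk n m V a b)⟩

theorem rep_sum {ι : Type*} (s : Finset ι) {x : ι → Completion n m V} {a b : ℕ} {v : ι → U}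
    (h : ∀ i ∈ s, Rep (x i) a b (v i)) : Rep (∑ i ∈ s, x i) a b (∑ i ∈ s, v i) := by
  classical
  induction s using Finset.induction with
  | empty => exact rep_zero a b
  | insert i s hi ih =>
    rw [Finset.sum_insert hi, Finset.sum_insert hi]
    exact (h i (Finset.mem_insert_self i s)).add
      (ih fun j hj => h j (Finset.mem_insert_of_mem hj))

theorem eq_of_rep_sub_mem {x y : Completion n m V} (h : ∀ a b, ∃ v w, Rep x a b v ∧ Rep y a b w ∧
    v - w ∈ filt n m V a b) : x = y :=
  ext_rep fun a b => by
    obtain ⟨v, w, hv, hw, hvw⟩ := h a b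
    exact ⟨w, hv.of_sub_mem hw.1 hvw, hw⟩

theorem const_eq_zero {v : U} (hv : v ∈ V.1) (h : ∀ a b, v ∈ filt n m V a b) :
    const n m v hv = 0 :=
  eq_of_rep_sub_mem fun a b => ⟨v, 0, rep_const hv a b, rep_zero a b, by simpa using h a b⟩

end Completion

namespace FinitaryCompletion

open Completion

theorem of_const (n m : Ideal Γ) {V : FGBimod Γ} {v : U} (hv : v ∈ V.1) :
    of n m V (const n m v hv) = image n m v := by
  rw [image, ← of_trans n m (FGBimod.gen_le hv)]
  rfl

/-- The map `u ↦ u_{𝔫,𝔪}` as a linear map. -/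
noncomputable def imageLin (n m : Ideal Γ) : U →ₗ[k] FinitaryCompletion n m where
  toFun := image n m
  map_add' u v := by
    obtain ⟨T, hu, hv⟩ := exists_ge_ge (FGBimod.gen Γ u) (FGBimod.gen Γ v)
    have hu := hu (FGBimod.mem_gen u)
    have hv := hv (FGBimod.mem_gen v)
    rw [← of_const n m hu, ← of_const n m hv, ← of_const n m (add_mem hu hv), ← map_add]
    rfl
  map_smul' c u := by
    have hu := FGBimod.mem_gen (Γ := Γ) u
    rw [← of_const n m hu, ← of_const n m (Submodule.smul_mem _ c hu), RingHom.id_apply, ← map_smul]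
    rfl

theorem image_eq_zero {n m : Ideal Γ} {u : U} (h : ∀ a b, u ∈ filt n m (FGBimod.gen Γ u) a b) :
    image n m u = 0 := by
  rw [image, const_eq_zero _ h, map_zero]

theorem image_one_of_isCoprime {n m : Ideal Γ} (h : IsCoprime n m) :
    image n m (1 : U) = 0 := by
  refine image_eq_zero fun a b => ?_
  obtain ⟨x, hx, y, hy, hxy⟩ := Ideal.isCoprime_iff_exists.1 (h.pow (m := a) (n := b))
  have hsplit : (x : U) * 1 + 1 * y = 1 := by
    rw [mul_one, one_mul, ← Subalgebra.coe_add, hxy, Subalgebra.coe_one]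
  have h1 := FGBimod.mem_gen (Γ := Γ) 1
  have hmem : (x : U) * 1 + 1 * y ∈ filt n m (FGBimod.gen Γ 1) a b :=
    Submodule.add_mem_sup (Submodule.mul_mem_mul (mem_idealSub hx) h1)
      (Submodule.mul_mem_mul h1 (mem_idealSub hy))
  rwa [hsplit] at hmem

theorem image_mul [Algebra.FiniteType k Γ] [IsHarishChandra Γ] (n m : Ideal Γ) [n.IsMaximal]
    (u v : U) {s : Finset (PierceCat Γ)}
    (hs : ∀ p : PierceCat Γ, rightAnn n (FGBimod.gen Γ u) ≤ p.ideal → p ∈ s) :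
    image n m (u * v) = ∑ p ∈ s, comp (image n p.ideal u) (image p.ideal m v) := by
  have hu := FGBimod.mem_gen (Γ := Γ) u
  have hv := FGBimod.mem_gen (Γ := Γ) v
  have huv : u * v ∈ ((FGBimod.gen Γ u).mul (FGBimod.gen Γ v)).1 := Submodule.mul_mem_mul hu hv
  rw [← of_const n m huv]
  simp only [image, comp_of]
  rw [← map_sum]
  congr 1
  refine eq_of_rep_sub_mem fun a b => ?_
  choose c γ h using fun p : PierceCat Γ => exists_isCut n p.ideal (FGBimod.gen Γ u) a
  refine ⟨_, _, rep_const huv a b, rep_sum s fun p _ =>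
    Rep.comp le_rfl (h p) (rep_const hu a (c p)) (rep_const hv (c p) b), ?_⟩
  have hsub : u * v - ∑ p ∈ s, u * γ p * v = u * (1 - ∑ p ∈ s, γ p : Γ) * v := by
    rw [Subalgebra.coe_sub, Subalgebra.coe_one, AddSubmonoidClass.coe_finsetSum, mul_sub, mul_one,
      sub_mul, Finset.mul_sum, Finset.sum_mul]
  rw [hsub]
  have hmem := Submodule.mul_mem_mul (one_sub_sum_mem_rightAnn h hs u hu) hv
  rw [mul_assoc] at hmem
  exact Submodule.mem_sup_left hmem

end FinitaryCompletion

namespace PierceCat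

theorem linked_iff_not_le {m n : PierceCat Γ} {u : U} : Linked u m n ↔
    ¬ (FGBimod.gen Γ u).1 ≤ filt n.ideal m.ideal (FGBimod.gen Γ u) 1 1 :=
  Submodule.Quotient.nontrivial_iff.trans (not_congr Submodule.comap_subtype_eq_top)

theorem Linked.rightAnn_le {m n : PierceCat Γ} {u : U} (h : Linked u m n) :
    rightAnn n.ideal (FGBimod.gen Γ u) ≤ m.ideal := by
  by_contra hle
  exact linked_iff_not_le.1 h <| le_filt_one_of_rightAnn_sup_eq_top <|
    (inferInstance : m.ideal.IsMaximal).1.2 _ (right_lt_sup.2 hle)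

theorem Linked.leftAnn_le {m n : PierceCat Γ} {u : U} (h : Linked u m n) :
    leftAnn m.ideal (FGBimod.gen Γ u) ≤ n.ideal := by
  by_contra hle
  exact linked_iff_not_le.1 h <| le_filt_one_of_sup_leftAnn_eq_top <|
    (inferInstance : n.ideal.IsMaximal).1.2 _ (left_lt_sup.2 hle)

variable [Algebra.FiniteType k Γ] [IsHarishChandra Γ]

theorem linked_of_image_ne_zero {m n : PierceCat Γ} {u : U} (h : image m n u ≠ 0) :
    Linked u m n := by
  rw [linked_iff_not_le]
  exact fun hle => h <| FinitaryCompletion.image_eq_zero fun a b =>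
    le_filt_of_le_filt_one hle a b (FGBimod.mem_gen u)

variable (Γ) in
/-- The matrix `[u]` with entry `u_{𝔫,𝔪}` in row `𝔫` and column `𝔪`. -/
noncomputable def imageMatrix (u : U) : RCFMatrix k (fun m : PierceCat Γ => m) :=
  ⟨fun n m => image m n u,
    fun n => (finite_rightAnn_le n.ideal (FGBimod.gen Γ u)).subset fun _ hm =>
      (linked_of_image_ne_zero hm).rightAnn_le,
    fun m => (finite_leftAnn_le m.ideal (FGBimod.gen Γ u)).subset fun _ hn =>
      (linked_of_image_ne_zero hn).leftAnn_le⟩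

theorem imageMatrix_one : imageMatrix Γ 1 = 1 := by
  refine RCFMatrix.ext' fun n m => ?_
  by_cases h : m = n
  · subst h
    exact (RCFMatrix.one_apply_same (k := k) (X := fun m : PierceCat Γ => m) m).symm
  · rw [RCFMatrix.one_apply_ne h]
    exact FinitaryCompletion.image_one_of_isCoprime (isCoprime_of_ne (Ne.symm h))

theorem imageMatrix_mul (u v : U) : imageMatrix Γ (u * v) = imageMatrix Γ u * imageMatrix Γ v := by
  refine RCFMatrix.ext' fun n m => ?_
  have hfin := finite_rightAnn_le n.ideal (FGBimod.gen Γ u)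
  rw [RCFMatrix.mul_apply, RCFMatrix.mulEntry_eq_sum _ _ n m hfin.toFinset fun p hp =>
    hfin.mem_toFinset.2 (linked_of_image_ne_zero hp).rightAnn_le]
  exact FinitaryCompletion.image_mul n.ideal m.ideal u v fun p hp => hfin.mem_toFinset.2 hp

variable (Γ) in
/-- The homomorphism `i_𝒜 : U → M_𝒜`, `u ↦ [u]`. -/
noncomputable def imageHom : U →ₐ[k] RCFMatrix k (fun m : PierceCat Γ => m) :=
  AlgHom.ofLinearMap
    { toFun := imageMatrix Γ
      map_add' := fun u v => RCFMatrix.ext' fun n m =>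
        map_add (FinitaryCompletion.imageLin n.ideal m.ideal) u v
      map_smul' := fun c u => RCFMatrix.ext' fun n m =>
        map_smul (FinitaryCompletion.imageLin n.ideal m.ideal) c u }
    imageMatrix_one imageMatrix_mul

end PierceCat

section Density

open Filter Topology

section ChineseRemainder

variable {ι κ : Type*} [Finite ι] [Finite κ] {I : ι → Ideal Γ} {J : κ → Ideal Γ}

theorem exists_forall_sub_mem_idealSub_mul (hI : Pairwise fun i j => IsCoprime (I i) (I j))
    (V : FGBimod Γ) {y : ι → U} (hy : ∀ i, y i ∈ V.1) :
    ∃ w ∈ V.1, ∀ i, w - y i ∈ idealSub (I i) * V.1 := by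
  classical
  have := Fintype.ofFinite ι
  choose e he using fun l => Ideal.exists_forall_sub_mem_ideal hI (Pi.single l (1 : Γ))
  refine ⟨∑ l, e l * y l, sum_mem fun l _ => V.left_mem (e l).2 (hy l), fun i => ?_⟩
  have hsplit : ∑ l, e l * y l - y i = ∑ l, ((e l - (Pi.single l 1 : ι → Γ) i : Γ) : U) * y l := by
    simp [sub_mul, Pi.single_apply, apply_ite ((↑) : Γ → U)]
  rw [hsplit]
  exact sum_mem fun l _ => Submodule.mul_mem_mul (mem_idealSub (he l i)) (hy l)

theorem exists_forall_sub_mem_mul_idealSub (hJ : Pairwise fun i j => IsCoprime (J i) (J j))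
    (V : FGBimod Γ) {y : κ → U} (hy : ∀ j, y j ∈ V.1) :
    ∃ w ∈ V.1, ∀ j, w - y j ∈ V.1 * idealSub (J j) := by
  classical
  have := Fintype.ofFinite κ
  choose e he using fun l => Ideal.exists_forall_sub_mem_ideal hJ (Pi.single l (1 : Γ))
  refine ⟨∑ l, y l * e l, sum_mem fun l _ => V.right_mem (hy l) (e l).2, fun j => ?_⟩
  have hsplit : ∑ l, y l * e l - y j = ∑ l, y l * ((e l - (Pi.single l 1 : κ → Γ) j : Γ) : U) := by
    simp [mul_sub, Pi.single_apply, apply_ite ((↑) : Γ → U)]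
  rw [hsplit]
  exact sum_mem fun l _ => Submodule.mul_mem_mul (hy l) (mem_idealSub (he l j))

theorem exists_forall_sub_mem_sup (hI : Pairwise fun i j => IsCoprime (I i) (I j))
    (hJ : Pairwise fun i j => IsCoprime (J i) (J j)) (V : FGBimod Γ) {v : ι → κ → U}
    (hv : ∀ i j, v i j ∈ V.1) :
    ∃ w ∈ V.1, ∀ i j, w - v i j ∈ idealSub (I i) * V.1 ⊔ V.1 * idealSub (J j) := by
  choose y hyV hy using fun i => exists_forall_sub_mem_mul_idealSub hJ V (hv i)
  obtain ⟨w, hwV, hw⟩ := exists_forall_sub_mem_idealSub_mul hI V hyV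
  refine ⟨w, hwV, fun i j => ?_⟩
  rw [← sub_add_sub_cancel w (y i)]
  exact Submodule.add_mem_sup (hw i) (hy i j)

end ChineseRemainder

theorem Completion.tendsto_const {n m : Ideal Γ} {V : FGBimod Γ} {x : Completion n m V}
    {v : ℕ → U} (h : ∀ b, Rep x b b (v b)) :
    Tendsto (fun b => const n m (v b) (h b).1) atTop (𝓝 x) := by
  simp only [nhds_iInf, tendsto_iInf]
  intro a b
  let _ : TopologicalSpace (filtQuot n m V a b) := ⊥
  have : DiscreteTopology (filtQuot n m V a b) := ⟨rfl⟩
  rw [nhds_induced, nhds_discrete, comap_pure, tendsto_principal]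
  filter_upwards [eventually_ge_atTop (max a b)] with c hc
  exact ((h c).mono (le_of_max_le_left hc) (le_of_max_le_right hc)).2

namespace FinitaryCompletion

theorem continuous_of (n m : Ideal Γ) (V : FGBimod Γ) : Continuous (of n m V) :=
  continuous_iSup_rng (continuous_coinduced_rng)

theorem tendsto_image {n m : Ideal Γ} {V : FGBimod Γ} {x : Completion n m V} {v : ℕ → U}
    (h : ∀ b, Completion.Rep x b b (v b)) :
    Tendsto (fun b => image n m (v b)) atTop (𝓝 (of n m V x)) :=
  (((continuous_of n m V).tendsto x).comp (Completion.tendsto_const h)).congr fun b =>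
    of_const n m (h b).1

theorem exists_forall_of_eq {ι : Type*} [Finite ι] {n m : ι → Ideal Γ}
    (x : ∀ i, FinitaryCompletion (n i) (m i)) : ∃ V, ∀ i, ∃ y, of (n i) (m i) V y = x i := by
  choose W y hy using fun i => exists_of (x i)
  obtain ⟨V, hV⟩ := Finite.exists_le W
  exact ⟨V, fun i => ⟨_, (of_trans (n i) (m i) (hV i) (y i)).trans (hy i)⟩⟩

end FinitaryCompletion

namespace PierceCat

variable [Algebra.FiniteType k Γ] [IsHarishChandra Γ]

theorem exists_tendsto_image {ι : Type*} [Finite ι] {X : ι → PierceCat Γ}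
    (hX : Function.Injective X) (F : ∀ i j, X j ⟶ X i) :
    ∃ w : ℕ → U, ∀ i j, Tendsto (fun b => image (X j) (X i) (w b)) atTop (𝓝 (F i j)) := by
  obtain ⟨V, hV⟩ := FinitaryCompletion.exists_forall_of_eq
    (n := fun p : ι × ι => (X p.1).ideal) (m := fun p => (X p.2).ideal) fun p => F p.1 p.2
  choose x hx using fun i j => hV (i, j)
  choose v hv using fun b i j => Completion.exists_rep (x i j) b b
  have hcop (b : ℕ) : Pairwise fun i j => IsCoprime ((X i).ideal ^ b) ((X j).ideal ^ b) :=
    fun i j hij => (isCoprime_of_ne (hX.ne hij)).pow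
  choose w hwV hw using fun b =>
    exists_forall_sub_mem_sup (hcop b) (hcop b) V fun i j => (hv b i j).1
  have hrep (i j : ι) (b : ℕ) : Completion.Rep (x i j) b b (w b) := by
    refine (hv b i j).of_sub_mem (hwV b) ?_
    rw [← neg_sub]
    exact neg_mem (hw b i j)
  refine ⟨w, fun i j => ?_⟩
  rw [← hx]
  exact FinitaryCompletion.tendsto_image (hrep i j)

theorem denseRange_block_imageHom (D : Set (PierceCat Γ)) :
    DenseRange fun u : U => RCFMatrix.block D (imageHom Γ u) := by
  classical
  intro F
  rw [RCFMatrix.isInducing_entries.closure_eq_preimage_closure_image, ← Set.range_comp]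
  refine mem_closure_range_of_forall_finset_tendsto fun s => ?_
  let t : Finset D := s.image Prod.fst ∪ s.image Prod.snd
  obtain ⟨w, hw⟩ := exists_tendsto_image (X := fun i : t => (i : D).1)
    (Subtype.val_injective.comp Subtype.val_injective) fun i j => F.1 i j
  refine ⟨map w atTop, inferInstance, fun p hp => tendsto_map'_iff.2 ?_⟩
  exact hw ⟨p.1, Finset.mem_union_left _ (Finset.mem_image_of_mem _ hp)⟩
    ⟨p.2, Finset.mem_union_right _ (Finset.mem_image_of_mem _ hp)⟩

end PierceCat

end Density

end GelfandTsetlin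

theorem mainTheorem12_general {k : Type w} {U : Type u} [Field k] [Ring U] [Algebra k U]
    (Γ : Subalgebra k U) [IsMulCommutative Γ] [Algebra.FiniteType k Γ] [IsHarishChandra Γ] :
    ∃ i : U →ₐ[k] RCFMatrix k (fun m : PierceCat Γ => m),
      (∀ (u : U) (n m : PierceCat Γ), (i u).1 n m = PierceCat.image m n u) ∧
      ∀ D : Set (PierceCat Γ), DenseRange fun u : U => RCFMatrix.block D (i u) :=
  ⟨PierceCat.imageHom Γ, fun _ _ _ => rfl, PierceCat.denseRange_block_imageHom⟩

theorem mainTheorem12 {k : Type w} {U : Type u} [Field k] [IsAlgClosed k] [CharZero k]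
    [Ring U] [Algebra k U] (Γ : Subalgebra k U) [IsMulCommutative Γ] [Algebra.FiniteType k Γ]
    [IsHarishChandra Γ] :
    ∃ i : U →ₐ[k] RCFMatrix k (fun m : PierceCat Γ => m),
      (∀ (u : U) (n m : PierceCat Γ), (i u).1 n m = PierceCat.image m n u) ∧
      ∀ D ∈ (PierceCat.linkage Γ).classes, DenseRange fun u : U => RCFMatrix.block D (i u) :=
  let ⟨i, hi, hd⟩ := mainTheorem12_general Γ
  ⟨i, hi, fun D _ => hd D⟩
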